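/- For every $d\in\mathbb N$, $d\ge 1$, and all $R>0$, $M>0$ there is a constant $C>0$, depending only on $d,R,M$, such that the following holds. Let $\mu,\nu$ be probability measures on $\mathbb R^d$ whose supports are contained in the open ball $B_R=\{x:\|x\|<R\}$, and suppose that $\mu$ has a density with respect to Lebesgue measure that is bounded above by $M$. Let $\Gamma_0(\mathbb R^d)$ be the set of proper lower semicontinuous convex functions $\varphi:\mathbb R^d\to\mathbb R\cup\{+\infty\}$, let $\varphi^*(y)=\sup_{x}\langle x,y\rangle-\varphi(x)$, and let $\bar\varphi$ be any Brenier potential for $(\mu,\nu)$, i.e. a minimizer of $\varphi\mapsto\int\varphi\,d\mu+\int\varphi^*\,d\nu$ over $\Gamma_0(\mathbb R^d)$. Let $n,m\ge 1$, let $X_1,\dots,X_n$ be i.i.d. with law $\mu$ and $Y_1,\dots,Y_m$ i.i.d. with law $\nu$, with empirical measures $\hat\mu_n=\frac1n\sum_i\delta_{X_i}$ and $\hat\nu_m=\frac1m\sum_j\delta_{Y_j}$. Let $(f,g)\in\mathbb R^n\times\mathbb R^m$ (depending on the samples) be any optimal solution of the dual transport linear program $$\max\Big\{\tfrac1n\sum_{i=1}^n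 f_i+\tfrac1m\sum_{j=1}^m g_j \;:\; f_i+g_j\le\tfrac12\|X_i-Y_j\|^2\ \text{ for all } i,j\Big\}.$$ Put $\varphi_g(x)=\max_{k=1,\dots,m}\langle x,Y_k\rangle+g_k-\tfrac12\|Y_k\|^2$, let $I(x)=\{j:\varphi_g(x)=\langle x,Y_j\rangle+g_j-\tfrac12\|Y_j\|^2\}$ be the set of active indices, and define the estimator $$\hat T_{n,m}(x)=\frac{1}{|I(x)|}\sum_{j\in I(x)}Y_j ,\qquad x\in\mathbb R^d.$$ Then $$\mathbb E\left[\int_{\mathbb R^d}\|\nabla\bar\varphi(x)-\hat T_{n,m}(x)\|\,d\mu(x)\right]\le C\begin{cases}\left(n^{-1/2}+m^{-1/2}\right)^{1/4}&\text{if } d=1,\\ \left(n^{-1/2}\log(1+n)+m^{-1/2}\log(1+m)\right)^{1/4}&\text{if } d=2,\\ \left(n^{-1/d}+m^{-1/d}\right)^{1/4}&\text{if } d>2.\end{cases}$$ -/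

import Mathlib

open MeasureTheory ProbabilityTheory

noncomputable section

namespace BrenierEstimation

/-- `ℝ^d` with the Euclidean norm. -/
abbrev E (d : ℕ) : Type := EuclideanSpace ℝ (Fin d)

/-- The class `Γ₀(ℝ^d)` of proper, lower semicontinuous, convex functions with values in
`ℝ ∪ {+∞}`. Convexity is convexity of the epigraph. -/
structure IsGammaZero {d : ℕ} (φ : E d → EReal) : Prop where
  convex_epigraph : Convex ℝ {p : E d × ℝ | φ p.1 ≤ (p.2 : EReal)}
  lowerSemicontinuous : LowerSemicontinuous φ
  ne_bot : ∀ x, φ x ≠ ⊥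
  proper : ∃ x, φ x ≠ ⊤

/-- The Fenchel-Legendre transform `φ^*(y) = sup_x ⟨x, y⟩ - φ(x)`. -/
def conjugate {d : ℕ} (φ : E d → EReal) (y : E d) : EReal :=
  ⨆ x : E d, ((inner ℝ x y : ℝ) : EReal) - φ x

/-- The integral of an extended-real-valued function, as the integral of its positive part minus
the integral of its negative part. For a function in `Γ₀` and a finite measure of bounded support,
the negative part has finite integral (the function has an affine minorant), so this is the usual
integral with values in `ℝ ∪ {+∞}`. -/
def extIntegral {d : ℕ} (φ : E d → EReal) (μ : Measure (E d)) : EReal :=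
  ((∫⁻ x, (φ x).toENNReal ∂μ : ENNReal) : EReal) - ((∫⁻ x, (-φ x).toENNReal ∂μ : ENNReal) : EReal)

/-- The dual functional `∫ φ dμ + ∫ φ^* dν`. -/
def dualObjective {d : ℕ} (μ ν : Measure (E d)) (φ : E d → EReal) : EReal :=
  extIntegral φ μ + extIntegral (conjugate φ) ν

/-- `φ` is a Brenier potential for `(μ, ν)`: it is an optimal solution of the dual problem
`inf_{φ ∈ Γ₀} ∫ φ dμ + ∫ φ^* dν`. -/
structure IsBrenierPotential {d : ℕ} (μ ν : Measure (E d)) (φ : E d → EReal) : Prop where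
  gammaZero : IsGammaZero φ
  optimal : ∀ ψ : E d → EReal, IsGammaZero ψ → dualObjective μ ν φ ≤ dualObjective μ ν ψ

/-- The gradient of an extended-real-valued function, meant at interior points of its domain
where it is differentiable. -/
def extGradient {d : ℕ} (φ : E d → EReal) (x : E d) : E d :=
  gradient (fun z => (φ z).toReal) x

/-- `μ` has a density with respect to Lebesgue measure, and this density is at most `M`. -/
def HasDensityAtMost {d : ℕ} (μ : Measure (E d)) (M : ℝ) : Prop :=
  ∃ ρ : E d → ENNReal, Measurable ρ ∧ μ = (volume : Measure (E d)).withDensity ρ ∧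
    ∀ᵐ x ∂(volume : Measure (E d)), ρ x ≤ ENNReal.ofReal M

/-- Feasible points `(f, g)` of the dual linear program of the optimal transport problem with cost
`C i j = ‖x i - y j‖² / 2`. -/
def IsDualFeasible {d n m : ℕ} (x : Fin n → E d) (y : Fin m → E d)
    (f : Fin n → ℝ) (g : Fin m → ℝ) : Prop :=
  ∀ i j, f i + g j ≤ ‖x i - y j‖ ^ 2 / 2

/-- `(f, g)` is an optimal solution of the dual linear program
`max ⟨f, a⟩ + ⟨g, b⟩` subject to `f i + g j ≤ ‖x i - y j‖² / 2`,
for the discrete measures `∑ i, a i • δ_{x i}` and `∑ j, b j • δ_{y j}`. -/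
structure IsDualOptimal {d n m : ℕ} (a : Fin n → ℝ) (x : Fin n → E d)
    (b : Fin m → ℝ) (y : Fin m → E d) (f : Fin n → ℝ) (g : Fin m → ℝ) : Prop where
  feasible : IsDualFeasible x y f g
  optimal : ∀ f' g', IsDualFeasible x y f' g' →
    ∑ i, f' i * a i + ∑ j, g' j * b j ≤ ∑ i, f i * a i + ∑ j, g j * b j

/-- `(f, g)` is an optimal solution of the dual linear program for the empirical measures
`n⁻¹ ∑ i, δ_{x i}` and `m⁻¹ ∑ j, δ_{y j}`. -/
def IsEmpiricalDualOptimal {d n m : ℕ} (x : Fin n → E d) (y : Fin m → E d)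
    (f : Fin n → ℝ) (g : Fin m → ℝ) : Prop :=
  IsDualOptimal (fun _ => (n : ℝ)⁻¹) x (fun _ => (m : ℝ)⁻¹) y f g

/-- The affine function `x ↦ ⟨x, y_k⟩ + g_k - ‖y_k‖² / 2`. -/
def affinePiece {d m : ℕ} (y : Fin m → E d) (g : Fin m → ℝ) (k : Fin m) (x : E d) : ℝ :=
  inner ℝ x (y k) + g k - ‖y k‖ ^ 2 / 2

/-- The explicit potential `φ_g(x) = max_k ⟨x, y_k⟩ + g_k - ‖y_k‖² / 2` (used for `m ≥ 1`). -/
def explicitPotential {d m : ℕ} (y : Fin m → E d) (g : Fin m → ℝ) (x : E d) : ℝ :=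
  ⨆ k : Fin m, affinePiece y g k x

open Classical in
/-- The set `I(x)` of active indices of `φ_g` at `x`. -/
def activeSet {d m : ℕ} (y : Fin m → E d) (g : Fin m → ℝ) (x : E d) : Finset (Fin m) :=
  Finset.univ.filter fun j => explicitPotential y g x = affinePiece y g j x

/-- The Monge map estimator: the average of the `y_j` over the active indices `j ∈ I(x)`. -/
def mongeEstimator {d m : ℕ} (y : Fin m → E d) (g : Fin m → ℝ) (x : E d) : E d :=
  ((activeSet y g x).card : ℝ)⁻¹ • ∑ j ∈ activeSet y g x, y j

/-- The convergence rate in dimension `d`. -/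
def rate (d n m : ℕ) : ℝ :=
  if d = 1 then
    ((n : ℝ) ^ (-(1 / 2) : ℝ) + (m : ℝ) ^ (-(1 / 2) : ℝ)) ^ (1 / 4 : ℝ)
  else if d = 2 then
    ((n : ℝ) ^ (-(1 / 2) : ℝ) * Real.log (1 + n)
      + (m : ℝ) ^ (-(1 / 2) : ℝ) * Real.log (1 + m)) ^ (1 / 4 : ℝ)
  else
    ((n : ℝ) ^ (-(1 / (d : ℝ))) + (m : ℝ) ^ (-(1 / (d : ℝ)))) ^ (1 / 4 : ℝ)

end BrenierEstimation

end

noncomputable section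

namespace BrenierEstimation

open Metric Set

variable {d : ℕ}

/-- The supremum `sup_{x ∈ S} ⟨x, y⟩ - h x` of the affine functions indexed by `S`. -/
def affineSup (S : Set (E d)) (h : E d → ℝ) (y : E d) : ℝ :=
  ⨆ x : S, (inner ℝ (x : E d) y - h x)

section affineSup

variable {S : Set (E d)} {h : E d → ℝ} {r c : ℝ}

lemma bddAbove_range_affine (hS : S ⊆ closedBall 0 r) (hc : ∀ x ∈ S, c ≤ h x) (y : E d) :
    BddAbove (range fun x : S => inner ℝ (x : E d) y - h x) := by
  refine ⟨r * ‖y‖ - c, ?_⟩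
  rintro _ ⟨⟨x, hx⟩, rfl⟩
  have h1 : inner ℝ x y ≤ ‖x‖ * ‖y‖ := real_inner_le_norm x y
  have h2 : ‖x‖ ≤ r := by simpa using hS hx
  have h3 := mul_le_mul_of_nonneg_right h2 (norm_nonneg y)
  have := hc x hx
  simp only
  linarith

lemma le_affineSup (hS : S ⊆ closedBall 0 r) (hc : ∀ x ∈ S, c ≤ h x) {x : E d} (hx : x ∈ S)
    (y : E d) : inner ℝ x y - h x ≤ affineSup S h y :=
  le_ciSup (bddAbove_range_affine hS hc y) ⟨x, hx⟩

lemma affineSup_le (hne : S.Nonempty) {y : E d} {b : ℝ}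
    (hb : ∀ x ∈ S, inner ℝ x y - h x ≤ b) : affineSup S h y ≤ b := by
  have := hne.to_subtype
  exact ciSup_le fun x => hb x x.2

lemma affineSup_lipschitz (hr : 0 ≤ r) (hne : S.Nonempty) (hS : S ⊆ closedBall 0 r)
    (hc : ∀ x ∈ S, c ≤ h x) : LipschitzWith r.toNNReal (affineSup S h) := by
  apply LipschitzWith.of_le_add_mul
  intro y z
  apply affineSup_le hne
  intro x hx
  have h1 := le_affineSup hS hc hx z
  have h2 : inner ℝ x (y - z) ≤ ‖x‖ * ‖y - z‖ := real_inner_le_norm _ _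
  rw [inner_sub_right] at h2
  have h3 : ‖x‖ ≤ r := by simpa using hS hx
  have h4 := mul_le_mul_of_nonneg_right h3 (norm_nonneg (y - z))
  rw [Real.coe_toNNReal r hr, dist_eq_norm]
  linarith

lemma affineSup_convexOn (hne : S.Nonempty) (hS : S ⊆ closedBall 0 r)
    (hc : ∀ x ∈ S, c ≤ h x) : ConvexOn ℝ univ (affineSup S h) := by
  refine ⟨convex_univ, fun y _ z _ α β hα hβ hαβ => ?_⟩
  apply affineSup_le hne
  intro x hx
  have h1 := mul_le_mul_of_nonneg_left (le_affineSup hS hc hx y) hα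
  have h2 := mul_le_mul_of_nonneg_left (le_affineSup hS hc hx z) hβ
  have h3 : h x = α * h x + β * h x := by rw [← add_mul, hαβ, one_mul]
  rw [inner_add_right, inner_smul_right, inner_smul_right, smul_eq_mul, smul_eq_mul]
  linarith

lemma exists_eq_affineSup (hne : S.Nonempty) (hS : IsCompact S) (hh : ContinuousOn h S)
    (y : E d) : ∃ x ∈ S, affineSup S h y = inner ℝ x y - h x := by
  have hcont : ContinuousOn (fun x : E d => inner ℝ x y - h x) S := by fun_prop
  obtain ⟨x, hx, hmax⟩ := hS.exists_isMaxOn hne hcont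
  refine ⟨x, hx, le_antisymm (affineSup_le hne fun z hz => hmax hz) ?_⟩
  refine le_ciSup (f := fun x : S => inner ℝ (x : E d) y - h x) ⟨inner ℝ x y - h x, ?_⟩ ⟨x, hx⟩
  rintro _ ⟨⟨z, hz⟩, rfl⟩
  exact hmax hz

lemma subgradient_affineSup (hS : S ⊆ closedBall 0 r) (hc : ∀ x ∈ S, c ≤ h x) {p x : E d}
    (hp : p ∈ S) (hx : affineSup S h x = inner ℝ p x - h p) (z : E d) :
    affineSup S h x + inner ℝ p (z - x) ≤ affineSup S h z := by
  have := le_affineSup hS hc hp z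
  rw [hx, inner_sub_right]
  linarith

/-- The supremum of the affine functions given by `(a + b) / 2` is bounded by the midpoint
inf-convolution of the suprema given by `a` and `b`. -/
lemma affineSup_midpoint_le {a b : E d → ℝ} {ca : ℝ} (hne : S.Nonempty)
    (hS : S ⊆ closedBall 0 r) (ha : ∀ x ∈ S, ca ≤ a x) {x k : E d} {v : ℝ}
    (hv : ∀ y ∈ S, inner ℝ (x - k) y - b y ≤ v) :
    2 * affineSup S (fun y => (a y + b y) / 2) x ≤ affineSup S a (x + k) + v := by
  have : affineSup S (fun y => (a y + b y) / 2) x ≤ (affineSup S a (x + k) + v) / 2 := by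
    apply affineSup_le hne
    intro y hy
    have h1 := le_affineSup hS ha hy (x + k)
    have h2 := hv y hy
    rw [inner_add_right] at h1
    rw [inner_sub_left, real_inner_comm, real_inner_comm y k] at h2
    linarith
  linarith

end affineSup

section explicitPotential

variable {m : ℕ} {y : Fin m → E d} {g : Fin m → ℝ}

lemma affinePiece_le_explicitPotential (k : Fin m) (x : E d) :
    affinePiece y g k x ≤ explicitPotential y g x :=
  le_ciSup (f := fun k => affinePiece y g k x) (Set.finite_range _).bddAbove k

lemma explicitPotential_le (hm : 0 < m) {x : E d} {b : ℝ} (hb : ∀ k, affinePiece y g k x ≤ b) :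
    explicitPotential y g x ≤ b := by
  have : Nonempty (Fin m) := ⟨⟨0, hm⟩⟩
  exact ciSup_le hb

lemma explicitPotential_lipschitz (hm : 0 < m) {r : ℝ} (hr : 0 ≤ r) (hy : ∀ k, ‖y k‖ ≤ r) :
    LipschitzWith r.toNNReal (explicitPotential y g) := by
  apply LipschitzWith.of_le_add_mul
  intro x z
  apply explicitPotential_le hm
  intro k
  have h1 := affinePiece_le_explicitPotential (y := y) (g := g) k z
  have h2 : inner ℝ (x - z) (y k) ≤ ‖x - z‖ * ‖y k‖ := real_inner_le_norm _ _
  rw [inner_sub_left] at h2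
  have h4 := mul_le_mul_of_nonneg_left (hy k) (norm_nonneg (x - z))
  rw [Real.coe_toNNReal r hr, dist_eq_norm]
  simp only [affinePiece] at *
  linarith

lemma activeSet_nonempty (hm : 0 < m) (x : E d) : (activeSet y g x).Nonempty := by
  have : Nonempty (Fin m) := ⟨⟨0, hm⟩⟩
  obtain ⟨k, hk⟩ := exists_eq_ciSup_of_finite (f := fun k => affinePiece y g k x)
  refine ⟨k, ?_⟩
  rw [activeSet, Finset.mem_filter]
  exact ⟨Finset.mem_univ k, hk.symm⟩

lemma subgradient_mongeEstimator (hm : 0 < m) (x z : E d) :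
    explicitPotential y g x + inner ℝ (mongeEstimator y g x) (z - x)
      ≤ explicitPotential y g z := by
  have hcard : (0 : ℝ) < (activeSet y g x).card := by
    exact_mod_cast (activeSet_nonempty hm x).card_pos
  have key : ∀ j ∈ activeSet y g x, inner ℝ (y j) (z - x)
      ≤ explicitPotential y g z - explicitPotential y g x := by
    intro j hj
    have hj' : explicitPotential y g x = affinePiece y g j x := by
      simpa [activeSet] using hj
    have h1 := affinePiece_le_explicitPotential (y := y) (g := g) j z
    rw [hj', inner_sub_right, real_inner_comm, real_inner_comm x]
    simp only [affinePiece] at *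
    linarith
  have hsum := Finset.sum_le_card_nsmul _ _ _ key
  rw [mongeEstimator, inner_smul_left, sum_inner]
  simp only [map_inv₀, conj_trivial, nsmul_eq_mul] at *
  have := mul_le_mul_of_nonneg_left hsum (inv_nonneg.2 hcard.le)
  rw [inv_mul_cancel_left₀ hcard.ne'] at this
  linarith

end explicitPotential

/-- The second difference of `w` at `x` in the direction `k`. -/
def secondDiff (w : E d → ℝ) (k x : E d) : ℝ := w (x + k) + w (x - k) - 2 * w x

lemma secondDiff_nonneg_of_subgradient {w : E d → ℝ} {x p : E d}
    (hp : ∀ z, w x + inner ℝ p (z - x) ≤ w z) (k : E d) : 0 ≤ secondDiff w k x := by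
  have h1 := hp (x + k)
  have h2 := hp (x - k)
  have e1 : x + k - x = k := by abel
  have e2 : x - k - x = -k := by abel
  rw [e1] at h1
  rw [e2, inner_neg_right] at h2
  rw [secondDiff]
  linarith

lemma abs_inner_sub_le_of_subgradient {u v : E d → ℝ} {x p q k : E d} {s : ℝ}
    (hp : ∀ z, u x + inner ℝ p (z - x) ≤ u z) (hq : ∀ z, v x + inner ℝ q (z - x) ≤ v z)
    (h1 : 2 * s ≤ u (x + k) + v (x - k)) (h2 : 2 * s ≤ u (x - k) + v (x + k)) :
    |inner ℝ (p - q) k| ≤ u x + v x - 2 * s + secondDiff u k x + secondDiff v k x := by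
  have e1 : x + k - x = k := by abel
  have e2 : x - k - x = -k := by abel
  have p1 := hp (x + k)
  have p2 := hp (x - k)
  have q1 := hq (x + k)
  have q2 := hq (x - k)
  rw [e1] at p1 q1
  rw [e2, inner_neg_right] at p2 q2
  rw [inner_sub_left, secondDiff, secondDiff, abs_le]
  constructor <;> linarith

lemma norm_le_sum_abs_inner (z : E d) :
    ‖z‖ ≤ ∑ i, |inner ℝ z (EuclideanSpace.single i (1 : ℝ))| := by
  have h := (EuclideanSpace.basisFun (Fin d) ℝ).sum_repr z
  calc ‖z‖ = ‖∑ i, (EuclideanSpace.basisFun (Fin d) ℝ).repr z i •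
        (EuclideanSpace.basisFun (Fin d) ℝ) i‖ := by rw [h]
    _ ≤ ∑ i, ‖(EuclideanSpace.basisFun (Fin d) ℝ).repr z i •
        (EuclideanSpace.basisFun (Fin d) ℝ) i‖ := norm_sum_le _ _
    _ = _ := by
      refine Finset.sum_congr rfl fun i _ => ?_
      rw [norm_smul]
      simp [EuclideanSpace.inner_single_right]

lemma integrable_of_continuous {μ : Measure (E d)} [IsFiniteMeasure μ] {R : ℝ}
    (hμ : ∀ᵐ x ∂μ, x ∈ ball 0 R) {w : E d → ℝ} (hw : Continuous w) : Integrable w μ := by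
  obtain ⟨C, hC⟩ := (isCompact_closedBall (0 : E d) R).exists_bound_of_continuousOn
    hw.continuousOn
  refine Integrable.of_bound hw.aestronglyMeasurable C ?_
  filter_upwards [hμ] with x hx using hC x (ball_subset_closedBall hx)

/-- The Lipschitz cutoff equal to at least one on the ball of radius `R` and supported in the
ball of radius `2 * R`. -/
def cutoff (R : ℝ) (x : E d) : ℝ := max 0 (2 - ‖x‖ / R)

lemma continuous_cutoff (R : ℝ) : Continuous (cutoff R : E d → ℝ) := by
  unfold cutoff; fun_prop

lemma cutoff_nonneg (R : ℝ) (x : E d) : 0 ≤ cutoff R x := le_max_left _ _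

lemma one_le_cutoff {R : ℝ} (hR : 0 < R) {x : E d} (hx : ‖x‖ ≤ R) : 1 ≤ cutoff R x := by
  refine le_max_of_le_right ?_
  have : ‖x‖ / R ≤ 1 := (div_le_one hR).2 hx
  linarith

lemma cutoff_eq_zero {R : ℝ} (hR : 0 < R) {x : E d} (hx : 2 * R ≤ ‖x‖) : cutoff R x = 0 := by
  refine max_eq_left ?_
  have : 2 ≤ ‖x‖ / R := (le_div_iff₀ hR).2 hx
  linarith

lemma abs_cutoff_sub_le {R : ℝ} (hR : 0 < R) (x z : E d) :
    |cutoff R x - cutoff R z| ≤ ‖x - z‖ / R := by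
  unfold cutoff
  rw [max_comm 0, max_comm 0]
  refine (abs_max_sub_max_le_abs (2 - ‖x‖ / R) (2 - ‖z‖ / R) 0).trans ?_
  have : 2 - ‖x‖ / R - (2 - ‖z‖ / R) = -((‖x‖ - ‖z‖) / R) := by ring
  rw [this, abs_neg, abs_div, abs_of_pos hR]
  gcongr
  exact abs_norm_sub_norm_le x z

lemma hasCompactSupport_cutoff {R : ℝ} (hR : 0 < R) :
    HasCompactSupport (cutoff R : E d → ℝ) := by
  refine HasCompactSupport.intro (isCompact_closedBall (0 : E d) (2 * R)) fun x hx => ?_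
  refine cutoff_eq_zero hR ?_
  rw [mem_closedBall_zero_iff, not_le] at hx
  exact hx.le

lemma integral_cutoff_mul_secondDiff_le {R : ℝ} (hR : 0 < R) {w : E d → ℝ}
    (hw : LipschitzWith R.toNNReal w) {k : E d} (hk : ‖k‖ ≤ R) :
    ∫ x, cutoff R x * secondDiff w k x
      ≤ ‖k‖ ^ 2 * (volume : Measure (E d)).real (closedBall 0 (3 * R)) := by
  have hwc := hw.continuous
  have hint : ∀ {f : E d → ℝ}, Continuous f → Integrable (fun x => cutoff R x * f x) := by
    intro f hf
    exact ((continuous_cutoff R).mul hf).integrable_of_hasCompactSupport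
      ((hasCompactSupport_cutoff hR).mul_right)
  have h1 := hint (f := fun x => w (x + k) - w x) (by fun_prop)
  have h2 := hint (f := fun x => w x - w (x - k)) (by fun_prop)
  have hshift : ∫ x, cutoff R x * (w x - w (x - k))
      = ∫ x, cutoff R (x + k) * (w (x + k) - w x) := by
    rw [← integral_add_right_eq_self _ k]
    simp
  have h2' : Integrable (fun x => cutoff R (x + k) * (w (x + k) - w x)) := by
    have := h2.comp_add_right k
    simpa using this
  have heq : ∫ x, cutoff R x * secondDiff w k x
      = ∫ x, (cutoff R x - cutoff R (x + k)) * (w (x + k) - w x) := by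
    calc ∫ x, cutoff R x * secondDiff w k x
        = ∫ x, (cutoff R x * (w (x + k) - w x) - cutoff R x * (w x - w (x - k))) := by
          refine integral_congr_ae (.of_forall fun x => ?_)
          simp only [secondDiff]; ring
      _ = _ := by
          rw [integral_sub h1 h2, hshift, ← integral_sub h1 h2']
          refine integral_congr_ae (.of_forall fun x => ?_)
          simp only; ring
  have hzero : ∀ x ∉ closedBall (0 : E d) (3 * R),
      (cutoff R x - cutoff R (x + k)) * (w (x + k) - w x) = 0 := by
    intro x hx
    rw [mem_closedBall_zero_iff, not_le] at hx
    have h3 : ‖x‖ ≤ ‖x + k‖ + ‖k‖ := by simpa using norm_sub_le (x + k) k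
    rw [cutoff_eq_zero hR (by linarith), cutoff_eq_zero hR (by linarith)]
    simp
  rw [heq, ← setIntegral_eq_integral_of_forall_compl_eq_zero hzero]
  refine (le_abs_self _).trans ?_
  rw [← Real.norm_eq_abs]
  refine norm_setIntegral_le_of_norm_le_const ?_ ?_
  · exact (isCompact_closedBall _ _).measure_lt_top
  · intro x _
    have e1 := abs_cutoff_sub_le hR x (x + k)
    have e2 := hw.dist_le_mul (x + k) x
    rw [Real.dist_eq, dist_eq_norm, Real.coe_toNNReal R hR.le] at e2
    have e3 : x - (x + k) = -k := by abel
    have e4 : x + k - x = k := by abel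
    rw [e3, norm_neg] at e1
    rw [e4] at e2
    rw [norm_mul, Real.norm_eq_abs, Real.norm_eq_abs]
    calc _ ≤ (‖k‖ / R) * (R * ‖k‖) := by gcongr
      _ = ‖k‖ ^ 2 := by field_simp

lemma HasDensityAtMost.le_smul_volume {μ : Measure (E d)} {M : ℝ} (h : HasDensityAtMost μ M) :
    μ ≤ ENNReal.ofReal M • (volume : Measure (E d)) := by
  obtain ⟨ρ, -, rfl, hρ⟩ := h
  calc (volume : Measure (E d)).withDensity ρ
      ≤ (volume : Measure (E d)).withDensity (fun _ => ENNReal.ofReal M) := withDensity_mono hρ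
    _ = _ := withDensity_const _

lemma integral_secondDiff_le {μ : Measure (E d)} [IsFiniteMeasure μ] {R M : ℝ} (hR : 0 < R)
    (hM : 0 ≤ M) (hμ : ∀ᵐ x ∂μ, x ∈ ball 0 R) (hden : HasDensityAtMost μ M) {w : E d → ℝ}
    (hw : LipschitzWith R.toNNReal w) {k : E d} (hk : ‖k‖ ≤ R)
    (hnonneg : ∀ x, 0 ≤ secondDiff w k x) :
    ∫ x, secondDiff w k x ∂μ
      ≤ M * (‖k‖ ^ 2 * (volume : Measure (E d)).real (closedBall 0 (3 * R))) := by
  have hwc := hw.continuous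
  have hcont : Continuous (secondDiff w k) := by unfold secondDiff; fun_prop
  have hint : Integrable (fun x => cutoff R x * secondDiff w k x) (volume : Measure (E d)) :=
    ((continuous_cutoff R).mul hcont).integrable_of_hasCompactSupport
      ((hasCompactSupport_cutoff hR).mul_right)
  have hnn : ∀ x, 0 ≤ cutoff R x * secondDiff w k x :=
    fun x => mul_nonneg (cutoff_nonneg R x) (hnonneg x)
  have hle : ENNReal.ofReal (∫ x, secondDiff w k x ∂μ)
      ≤ ENNReal.ofReal (M * ∫ x, cutoff R x * secondDiff w k x) := by
    rw [ofReal_integral_eq_lintegral_ofReal (integrable_of_continuous hμ hcont)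
      (.of_forall hnonneg), ENNReal.ofReal_mul hM,
      ofReal_integral_eq_lintegral_ofReal hint (.of_forall hnn), ← smul_eq_mul,
      ← lintegral_smul_measure]
    refine (lintegral_mono_ae ?_).trans (lintegral_mono' hden.le_smul_volume le_rfl)
    filter_upwards [hμ] with x hx
    refine ENNReal.ofReal_le_ofReal ?_
    have h1 := one_le_cutoff hR (mem_ball_zero_iff.1 hx).le
    nlinarith [hnonneg x]
  rw [ENNReal.ofReal_le_ofReal_iff (mul_nonneg hM (integral_nonneg hnn))] at hle
  refine hle.trans ?_
  gcongr
  exact integral_cutoff_mul_secondDiff_le hR hw hk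

/-- The index of the cubic cell of side `R / k` that contains `x`. -/
def cellIndex (R : ℝ) (k : ℕ) (x : E d) : Fin d → ℤ := fun i => ⌊(k : ℝ) * x i / R⌋

/-- The lower corner of the cubic cell with index `c`. -/
def cellCorner (R : ℝ) (k : ℕ) (c : Fin d → ℤ) : E d := WithLp.toLp 2 fun i => (c i : ℝ) * R / k

/-- The indices of the cells that meet the ball of radius `R`. -/
def cells (d k : ℕ) : Finset (Fin d → ℤ) := Fintype.piFinset fun _ => Finset.Icc (-(k : ℤ)) k

lemma card_cells (d k : ℕ) : (cells d k).card = (2 * k + 1) ^ d := by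
  have : ((k : ℤ) + 1 + (k : ℤ)).toNat = 2 * k + 1 := by omega
  simp [cells, Fintype.card_piFinset, this]

lemma measurable_cellIndex (R : ℝ) (k : ℕ) :
    Measurable (cellIndex R k : E d → Fin d → ℤ) := by
  refine measurable_pi_lambda _ fun i => ?_
  apply Int.measurable_floor.comp
  fun_prop

lemma measurableSet_cell (R : ℝ) (k : ℕ) (c : Fin d → ℤ) :
    MeasurableSet (cellIndex R k ⁻¹' {c} : Set (E d)) :=
  measurable_cellIndex R k (measurableSet_singleton c)

lemma norm_le_card_mul {z : E d} {b : ℝ} (hz : ∀ i, |z i| ≤ b) : ‖z‖ ≤ d * b := by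
  refine (norm_le_sum_abs_inner z).trans ?_
  have : ∀ i ∈ Finset.univ, |inner ℝ z (EuclideanSpace.single i (1 : ℝ))| ≤ b := by
    intro i _
    simpa [EuclideanSpace.inner_single_right] using hz i
  simpa using Finset.sum_le_card_nsmul _ _ _ this

lemma cellIndex_mem_cells {R : ℝ} (hR : 0 < R) {k : ℕ} {x : E d} (hx : ‖x‖ < R) :
    cellIndex R k x ∈ cells d k := by
  simp only [cells, Fintype.mem_piFinset, Finset.mem_Icc, cellIndex]
  intro i
  have h1 : |x i| ≤ R := by
    have := PiLp.norm_apply_le x i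
    rw [Real.norm_eq_abs] at this
    linarith
  rw [abs_le] at h1
  have hk : (0 : ℝ) ≤ k := Nat.cast_nonneg k
  constructor
  · rw [Int.le_floor, le_div_iff₀ hR]
    push_cast
    nlinarith
  · have : (k : ℝ) * x i / R ≤ ((k : ℤ) : ℝ) := by
      rw [div_le_iff₀ hR]
      push_cast
      nlinarith
    exact_mod_cast (Int.floor_le _).trans this

lemma norm_sub_cellCorner_le {R : ℝ} (hR : 0 < R) {k : ℕ} (hk : 0 < k) (x : E d) :
    ‖x - cellCorner R k (cellIndex R k x)‖ ≤ d * (R / k) := by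
  apply norm_le_card_mul
  intro i
  have hk' : (0 : ℝ) < k := Nat.cast_pos.2 hk
  have h1 := Int.floor_le ((k : ℝ) * x i / R)
  have h2 := (Int.lt_floor_add_one ((k : ℝ) * x i / R)).le
  rw [le_div_iff₀ hR] at h1
  rw [div_le_iff₀ hR] at h2
  simp only [PiLp.sub_apply, cellCorner, cellIndex]
  rw [abs_le]
  constructor
  · have : (⌊(k : ℝ) * x i / R⌋ : ℝ) * R / k ≤ x i := by
      rw [div_le_iff₀ hk']; linarith
    have : 0 ≤ R / k := by positivity
    linarith
  · have : x i ≤ (⌊(k : ℝ) * x i / R⌋ : ℝ) * R / k + R / k := by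
      rw [← add_div, le_div_iff₀ hk']; linarith
    linarith

lemma norm_cellCorner_le {R : ℝ} (hR : 0 < R) {k : ℕ} (hk : 0 < k) {c : Fin d → ℤ}
    (hc : c ∈ cells d k) : ‖(cellCorner R k c : E d)‖ ≤ d * R := by
  apply norm_le_card_mul
  intro i
  simp only [cells, Fintype.mem_piFinset, Finset.mem_Icc] at hc
  have hk' : (0 : ℝ) < k := Nat.cast_pos.2 hk
  have h1 : (-(k : ℝ)) ≤ c i := by exact_mod_cast (hc i).1
  have h2 : (c i : ℝ) ≤ k := by exact_mod_cast (hc i).2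
  simp only [cellCorner]
  rw [abs_div, abs_mul, abs_of_pos hR, abs_of_pos hk', div_le_iff₀ hk']
  have : |(c i : ℝ)| ≤ k := abs_le.2 ⟨h1, h2⟩
  nlinarith

/-- The discrepancy between `μ` and the empirical measure of `x` on a measurable set. -/
def setDiscrepancy (μ : Measure (E d)) {n : ℕ} (B : Set (E d)) (x : Fin n → E d) : ℝ :=
  μ.real B - (n : ℝ)⁻¹ * ∑ i, B.indicator (fun _ => (1 : ℝ)) (x i)

/-- The total discrepancy between `μ` and the empirical measure of `x` on cubic cells. -/
def cellDiscrepancy (μ : Measure (E d)) (R : ℝ) (k : ℕ) {n : ℕ} (x : Fin n → E d) : ℝ :=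
  ∑ c ∈ cells d k, |setDiscrepancy μ (cellIndex R k ⁻¹' {c}) x|

lemma abs_integral_sub_average_le {μ : Measure (E d)} [IsProbabilityMeasure μ] {R : ℝ}
    (hR : 0 < R) (hμ : ∀ᵐ x ∂μ, x ∈ ball 0 R) {k : ℕ} (hk : 0 < k) {n : ℕ} (hn : 0 < n)
    {x : Fin n → E d} (hx : ∀ i, x i ∈ ball 0 R) {L : NNReal} {w : E d → ℝ}
    (hw : LipschitzWith L w) :
    |∫ z, w z ∂μ - (n : ℝ)⁻¹ * ∑ i, w (x i)|
      ≤ L * (2 * (d * (R / k)) + d * R * cellDiscrepancy μ R k x) := by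
  have hn' : (0 : ℝ) < n := Nat.cast_pos.2 hn
  set B : (Fin d → ℤ) → Set (E d) := fun c => cellIndex R k ⁻¹' {c} with hB
  set q : (Fin d → ℤ) → ℝ := fun c => w (cellCorner R k c) - w 0 with hq
  set s : E d → ℝ := fun z => ∑ c ∈ cells d k, q c * (B c).indicator (fun _ => (1 : ℝ)) z with hs
  have hlip : ∀ a b, |w a - w b| ≤ L * ‖a - b‖ := by
    intro a b
    have := hw.dist_le_mul a b
    rwa [Real.dist_eq, dist_eq_norm] at this
  have hsint : ∀ c, Integrable (fun z => q c * (B c).indicator (fun _ => (1 : ℝ)) z) μ := fun c =>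
    ((integrable_const (1 : ℝ)).indicator (measurableSet_cell R k c)).const_mul _
  have hs_int : Integrable s μ := integrable_finsetSum _ fun c _ => hsint c
  have hs_eq : ∀ z ∈ ball (0 : E d) R, |w z - w 0 - s z| ≤ L * (d * (R / k)) := by
    intro z hz
    have hz' : s z = q (cellIndex R k z) := by
      simp only [hs]
      rw [Finset.sum_eq_single (cellIndex R k z)]
      · simp [hB]
      · intro c _ hc
        simp [hB, Set.indicator, hc.symm]
      · intro h
        exact absurd (cellIndex_mem_cells hR (mem_ball_zero_iff.1 hz)) h
    rw [hz', hq]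
    have e : w z - w 0 - (w (cellCorner R k (cellIndex R k z)) - w 0)
        = w z - w (cellCorner R k (cellIndex R k z)) := by ring
    simp only [e]
    exact (hlip _ _).trans (by gcongr; exact norm_sub_cellCorner_le hR hk z)
  have hwint : Integrable w μ := integrable_of_continuous hμ hw.continuous
  have h1 : |∫ z, (w z - w 0 - s z) ∂μ| ≤ L * (d * (R / k)) := by
    have := norm_integral_le_of_norm_le_const (μ := μ) (f := fun z => w z - w 0 - s z)
      (C := L * (d * (R / k))) (by filter_upwards [hμ] with z hz using hs_eq z hz)
    simpa using this
  have h2 : |(n : ℝ)⁻¹ * ∑ i, (w (x i) - w 0 - s (x i))| ≤ L * (d * (R / k)) := by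
    have h3 : |∑ i, (w (x i) - w 0 - s (x i))| ≤ n * (L * (d * (R / k))) := by
      refine (Finset.abs_sum_le_sum_abs _ _).trans ?_
      simpa using Finset.sum_le_card_nsmul Finset.univ _ _ fun i _ => hs_eq (x i) (hx i)
    rw [abs_mul, abs_of_pos (inv_pos.2 hn'), inv_mul_le_iff₀ hn']
    exact h3
  have h4 : ∫ z, s z ∂μ - (n : ℝ)⁻¹ * ∑ i, s (x i)
      = ∑ c ∈ cells d k, q c * setDiscrepancy μ (B c) x := by
    simp only [hs]
    rw [integral_finsetSum _ fun c _ => hsint c, Finset.sum_comm, Finset.mul_sum,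
      ← Finset.sum_sub_distrib]
    refine Finset.sum_congr rfl fun c _ => ?_
    rw [integral_const_mul, integral_indicator_const _ (measurableSet_cell R k c),
      ← Finset.mul_sum, setDiscrepancy]
    simp only [smul_eq_mul, mul_one]
    ring
  have h5 : |∫ z, s z ∂μ - (n : ℝ)⁻¹ * ∑ i, s (x i)|
      ≤ L * (d * R * cellDiscrepancy μ R k x) := by
    rw [h4, cellDiscrepancy, Finset.mul_sum, Finset.mul_sum]
    refine (Finset.abs_sum_le_sum_abs _ _).trans (Finset.sum_le_sum fun c hc => ?_)
    rw [abs_mul, ← mul_assoc]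
    gcongr
    refine (hlip _ _).trans ?_
    rw [sub_zero]
    gcongr
    exact norm_cellCorner_le hR hk hc
  have h6 : ∫ z, (w z - w 0 - s z) ∂μ = ∫ z, w z ∂μ - w 0 - ∫ z, s z ∂μ := by
    have hwint' : Integrable (fun z => w z - w 0) μ := hwint.sub (integrable_const _)
    rw [integral_sub hwint' hs_int, integral_sub hwint (integrable_const _)]
    simp
  have h7 : (n : ℝ)⁻¹ * ∑ i, (w (x i) - w 0 - s (x i))
      = (n : ℝ)⁻¹ * ∑ i, w (x i) - w 0 - (n : ℝ)⁻¹ * ∑ i, s (x i) := by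
    rw [Finset.sum_sub_distrib, Finset.sum_sub_distrib]
    simp only [Finset.sum_const, Finset.card_univ, Fintype.card_fin, nsmul_eq_mul]
    field_simp
  rw [h6] at h1
  rw [h7] at h2
  rw [abs_le] at *
  constructor <;> linarith [h1.1, h1.2, h2.1, h2.2, h5.1, h5.2]

section expectation

variable {Ω : Type*} [MeasurableSpace Ω] {P : Measure Ω} [IsProbabilityMeasure P]
  {μ : Measure (E d)} {n : ℕ} {X : Fin n → Ω → E d}

lemma memLp_indicator_comp {B : Set (E d)} (hB : MeasurableSet B) {Z : Ω → E d}
    (hZ : AEMeasurable Z P) (p : ENNReal) :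
    MemLp (fun ω => B.indicator (fun _ => (1 : ℝ)) (Z ω)) p P := by
  refine MemLp.of_bound ?_ 1 (.of_forall fun ω => ?_)
  · exact ((measurable_const.indicator hB).comp_aemeasurable hZ).aestronglyMeasurable
  · by_cases h : Z ω ∈ B <;> simp [h]

lemma memLp_setDiscrepancy (hX : ∀ i, HasLaw (X i) μ P) {B : Set (E d)} (hB : MeasurableSet B)
    (p : ENNReal) : MemLp (fun ω => setDiscrepancy μ B fun i => X i ω) p P := by
  unfold setDiscrepancy
  refine (memLp_const _).sub (MemLp.const_mul ?_ _)
  exact memLp_finsetSum _ fun i _ => memLp_indicator_comp hB (hX i).aemeasurable p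

lemma integral_setDiscrepancy_sq_le (hn : 0 < n) (hX : ∀ i, HasLaw (X i) μ P)
    (hind : iIndepFun X P) {B : Set (E d)} (hB : MeasurableSet B) :
    ∫ ω, (setDiscrepancy μ B fun i => X i ω) ^ 2 ∂P ≤ μ.real B / n := by
  have hn' : (0 : ℝ) < n := Nat.cast_pos.2 hn
  have hmeas : Measurable (B.indicator fun _ => (1 : ℝ)) := measurable_const.indicator hB
  set W : Fin n → Ω → ℝ := fun i ω => B.indicator (fun _ => (1 : ℝ)) (X i ω) with hW
  have hWL : ∀ i, MemLp (W i) 2 P := fun i => memLp_indicator_comp hB (hX i).aemeasurable 2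
  have hWI : ∀ i, ∫ ω, W i ω ∂P = μ.real B := by
    intro i
    have := (hX i).integral_comp (f := B.indicator fun _ => (1 : ℝ)) hmeas.aestronglyMeasurable
    rw [integral_indicator_const _ hB] at this
    simpa [Function.comp_def] using this
  have hSL : MemLp (fun ω => (n : ℝ)⁻¹ * ∑ i, W i ω) 2 P :=
    (memLp_finsetSum _ fun i _ => hWL i).const_mul _
  have hmean : ∫ ω, (n : ℝ)⁻¹ * ∑ i, W i ω ∂P = μ.real B := by
    rw [integral_const_mul, integral_finsetSum _ fun i _ => (hWL i).integrable one_le_two]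
    simp only [hWI, Finset.sum_const, Finset.card_univ, Fintype.card_fin, nsmul_eq_mul]
    field_simp
  have hvarW : ∀ i, variance (W i) P ≤ μ.real B := by
    intro i
    refine (variance_le_expectation_sq (hWL i).aestronglyMeasurable).trans (le_of_eq ?_)
    rw [← hWI i]
    refine integral_congr_ae (.of_forall fun ω => ?_)
    simp only [hW, Pi.pow_apply]
    by_cases h : X i ω ∈ B <;> simp [h]
  have hvar : variance (fun ω => (n : ℝ)⁻¹ * ∑ i, W i ω) P
      = ∫ ω, (setDiscrepancy μ B fun i => X i ω) ^ 2 ∂P := by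
    rw [variance_eq_integral hSL.aemeasurable, hmean]
    refine integral_congr_ae (.of_forall fun ω => ?_)
    simp only [setDiscrepancy, hW]
    ring
  have hsum : variance (fun ω => ∑ i, W i ω) P = ∑ i, variance (W i) P := by
    have := IndepFun.variance_sum (s := Finset.univ) (μ := P) (X := W) (fun i _ => hWL i) ?_
    · rw [← this]
      congr 1
      ext ω
      simp
    · intro i _ j _ hij
      exact (hind.indepFun hij).comp hmeas hmeas
  rw [← hvar, variance_const_mul, hsum]
  have : ∑ i, variance (W i) P ≤ n * μ.real B := by
    simpa using Finset.sum_le_card_nsmul Finset.univ _ _ fun i _ => hvarW i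
  calc (n : ℝ)⁻¹ ^ 2 * ∑ i, variance (W i) P ≤ (n : ℝ)⁻¹ ^ 2 * (n * μ.real B) := by gcongr
    _ = μ.real B / n := by field_simp

lemma integrable_cellDiscrepancy (hX : ∀ i, HasLaw (X i) μ P) (R : ℝ) (k : ℕ) :
    Integrable (fun ω => cellDiscrepancy μ R k fun i => X i ω) P := by
  unfold cellDiscrepancy
  exact integrable_finsetSum _ fun c _ =>
    ((memLp_setDiscrepancy hX (measurableSet_cell R k c) 1).integrable le_rfl).abs

lemma sum_measureReal_cell_le [IsProbabilityMeasure μ] (R : ℝ) (k : ℕ) :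
    ∑ c ∈ cells d k, μ.real (cellIndex R k ⁻¹' {c}) ≤ 1 := by
  rw [← measureReal_biUnion_finset]
  · exact measureReal_le_one
  · intro a _ b _ hab
    exact Disjoint.preimage _ (by simpa using hab)
  · exact fun c _ => measurableSet_cell R k c

lemma integral_cellDiscrepancy_le [IsProbabilityMeasure μ] (hn : 0 < n) (hX : ∀ i, HasLaw (X i) μ P)
    (hind : iIndepFun X P) (R : ℝ) (k : ℕ) {l : ℝ} (hl : 0 < l) :
    ∫ ω, cellDiscrepancy μ R k (fun i => X i ω) ∂P
      ≤ ((2 * k + 1) ^ d * l + 1 / (n * l)) / 2 := by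
  have hn' : (0 : ℝ) < n := Nat.cast_pos.2 hn
  have hint := fun c => (memLp_setDiscrepancy hX (measurableSet_cell R k c) 1).integrable le_rfl
  have hone : ∀ c, ∫ ω, |setDiscrepancy μ (cellIndex R k ⁻¹' {c}) fun i => X i ω| ∂P
      ≤ l / 2 + μ.real (cellIndex R k ⁻¹' {c}) / (2 * n * l) := by
    intro c
    have hsq := (memLp_setDiscrepancy hX (measurableSet_cell R k c) 2).integrable_sq
    calc ∫ ω, |setDiscrepancy μ (cellIndex R k ⁻¹' {c}) fun i => X i ω| ∂P
        ≤ ∫ ω, (l / 2 + (2 * l)⁻¹ *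
            (setDiscrepancy μ (cellIndex R k ⁻¹' {c}) fun i => X i ω) ^ 2) ∂P := by
          refine integral_mono (hint c).abs ((integrable_const _).add (hsq.const_mul _))
            fun ω => ?_
          simp only
          set z := setDiscrepancy μ (cellIndex R k ⁻¹' {c}) fun i => X i ω
          have e : l / 2 + (2 * l)⁻¹ * z ^ 2 - |z| = (2 * l)⁻¹ * (|z| - l) ^ 2 := by
            rw [sub_sq, sq_abs]
            field_simp
            ring
          have : 0 ≤ (2 * l)⁻¹ * (|z| - l) ^ 2 := by positivity
          linarith
      _ = l / 2 + (2 * l)⁻¹ *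
            ∫ ω, (setDiscrepancy μ (cellIndex R k ⁻¹' {c}) fun i => X i ω) ^ 2 ∂P := by
          rw [integral_add (integrable_const _) (hsq.const_mul _), integral_const_mul]
          simp
      _ ≤ l / 2 + (2 * l)⁻¹ * (μ.real (cellIndex R k ⁻¹' {c}) / n) := by
          gcongr
          exact integral_setDiscrepancy_sq_le hn hX hind (measurableSet_cell R k c)
      _ = _ := by field_simp
  unfold cellDiscrepancy
  rw [integral_finsetSum _ fun c _ => (hint c).abs]
  refine (Finset.sum_le_sum fun c _ => hone c).trans ?_
  rw [Finset.sum_add_distrib, Finset.sum_const, card_cells, nsmul_eq_mul, ← Finset.sum_div]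
  have h1 := sum_measureReal_cell_le (μ := μ) R k
  have h2 : (∑ c ∈ cells d k, μ.real (cellIndex R k ⁻¹' {c})) / (2 * n * l) ≤ 1 / (2 * n * l) := by
    gcongr
  push_cast
  calc _ ≤ (2 * (k : ℝ) + 1) ^ d * (l / 2) + 1 / (2 * n * l) := by linarith
    _ = _ := by field_simp

/-- The exponent of the bound on the empirical discrepancy for Lipschitz functions. -/
def discrepancyExponent (d : ℕ) : ℝ := 1 / (2 * max (d : ℝ) 2)

lemma discrepancyExponent_pos (d : ℕ) : 0 < discrepancyExponent d := by
  unfold discrepancyExponent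
  have : (2 : ℝ) ≤ max (d : ℝ) 2 := le_max_right _ _
  positivity

lemma discrepancyExponent_le (d : ℕ) : discrepancyExponent d ≤ 1 / 4 := by
  unfold discrepancyExponent
  have : (2 : ℝ) ≤ max (d : ℝ) 2 := le_max_right _ _
  exact one_div_le_one_div_of_le (by norm_num) (by linarith)

lemma discrepancyExponent_mul_le (d : ℕ) : discrepancyExponent d * d ≤ 1 / 2 := by
  unfold discrepancyExponent
  have h1 : (2 : ℝ) ≤ max (d : ℝ) 2 := le_max_right _ _
  have h2 : (d : ℝ) ≤ max (d : ℝ) 2 := le_max_left _ _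
  rw [one_div_mul_eq_div, div_le_div_iff₀ (by positivity) (by norm_num)]
  linarith

/-- Expected discrepancy between a measure and its empirical measure, uniformly over Lipschitz
functions. -/
lemma exists_discrepancy_bound [IsProbabilityMeasure μ] {R : ℝ} (hR : 0 < R) (hμ : ∀ᵐ x ∂μ, x ∈ ball 0 R) (hn : 0 < n)
    (hX : ∀ i, HasLaw (X i) μ P) (hind : iIndepFun X P) :
    ∃ D : Ω → ℝ, Integrable D P ∧ (∀ ω, 0 ≤ D ω) ∧
      ∫ ω, D ω ∂P ≤ d * R * (2 + 5 ^ d) * (n : ℝ) ^ (-discrepancyExponent d) ∧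
      ∀ᵐ ω ∂P, ∀ (L : NNReal) (w : E d → ℝ), LipschitzWith L w →
        |∫ z, w z ∂μ - (n : ℝ)⁻¹ * ∑ i, w (X i ω)| ≤ L * D ω := by
  set α := discrepancyExponent d with hα
  have hα0 := discrepancyExponent_pos d
  have hα4 := discrepancyExponent_le d
  have hαd := discrepancyExponent_mul_le d
  have hn' : (0 : ℝ) < n := Nat.cast_pos.2 hn
  have hn1 : (1 : ℝ) ≤ n := by exact_mod_cast hn
  have hnα : 1 ≤ (n : ℝ) ^ α := Real.one_le_rpow hn1 hα0.le
  set k := ⌈(n : ℝ) ^ α⌉₊ with hk_def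
  have hk1 : (n : ℝ) ^ α ≤ k := Nat.le_ceil _
  have hk2 : (k : ℝ) < (n : ℝ) ^ α + 1 := Nat.ceil_lt_add_one (by positivity)
  have hk : 0 < k := by
    have : (0 : ℝ) < k := by linarith
    exact_mod_cast this
  refine ⟨fun ω => 2 * (d * (R / k)) + d * R * cellDiscrepancy μ R k (fun i => X i ω),
    (integrable_const _).add ((integrable_cellDiscrepancy hX R k).const_mul _), ?_, ?_, ?_⟩
  · intro ω
    have : 0 ≤ cellDiscrepancy μ R k (fun i => X i ω) :=
      Finset.sum_nonneg fun c _ => abs_nonneg _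
    positivity
  · rw [integral_add (integrable_const _) ((integrable_cellDiscrepancy hX R k).const_mul _),
      integral_const_mul ((d : ℝ) * R)]
    have hl : 0 < (n : ℝ) ^ (-(3 / 4) : ℝ) := by positivity
    have h1 := integral_cellDiscrepancy_le hn hX hind R k hl
    have h2 : (1 : ℝ) / k ≤ (n : ℝ) ^ (-α) := by
      rw [Real.rpow_neg hn'.le, ← one_div]
      exact one_div_le_one_div_of_le (by positivity) hk1
    have h3 : (2 * (k : ℝ) + 1) ^ d ≤ 5 ^ d * (n : ℝ) ^ (1 / 2 : ℝ) := by
      calc (2 * (k : ℝ) + 1) ^ d ≤ (5 * (n : ℝ) ^ α) ^ d := by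
            gcongr; linarith
        _ = 5 ^ d * (n : ℝ) ^ (α * d) := by
            rw [mul_pow, Real.rpow_mul hn'.le, Real.rpow_natCast]
        _ ≤ _ := by
            gcongr
    have h4 : (n : ℝ) ^ (1 / 2 : ℝ) * (n : ℝ) ^ (-(3 / 4) : ℝ) = (n : ℝ) ^ (-(1 / 4) : ℝ) := by
      rw [← Real.rpow_add hn']; norm_num
    have h5 : 1 / (n * (n : ℝ) ^ (-(3 / 4) : ℝ)) = (n : ℝ) ^ (-(1 / 4) : ℝ) := by
      have : (n : ℝ) * (n : ℝ) ^ (-(3 / 4) : ℝ) = (n : ℝ) ^ (1 / 4 : ℝ) := by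
        nth_rewrite 1 [← Real.rpow_one (n : ℝ)]
        rw [← Real.rpow_add hn']; norm_num
      rw [this, Real.rpow_neg hn'.le, one_div]
    have h6 : (n : ℝ) ^ (-(1 / 4) : ℝ) ≤ (n : ℝ) ^ (-α) :=
      Real.rpow_le_rpow_of_exponent_le hn1 (by linarith)
    have h7 : (1 : ℝ) ≤ 5 ^ d := one_le_pow₀ (by norm_num)
    have h8 : ∫ ω, cellDiscrepancy μ R k (fun i => X i ω) ∂P ≤ 5 ^ d * (n : ℝ) ^ (-α) := by
      refine h1.trans ?_
      rw [h5]
      calc ((2 * (k : ℝ) + 1) ^ d * (n : ℝ) ^ (-(3 / 4) : ℝ) + (n : ℝ) ^ (-(1 / 4) : ℝ)) / 2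
          ≤ (5 ^ d * (n : ℝ) ^ (1 / 2 : ℝ) * (n : ℝ) ^ (-(3 / 4) : ℝ)
            + (n : ℝ) ^ (-(1 / 4) : ℝ)) / 2 := by gcongr
        _ = (5 ^ d + 1) / 2 * (n : ℝ) ^ (-(1 / 4) : ℝ) := by rw [mul_assoc, h4]; ring
        _ ≤ 5 ^ d * (n : ℝ) ^ (-α) := by
            gcongr
            linarith
    have h9 : 2 * (d * (R / k)) ≤ 2 * (d * (R * (n : ℝ) ^ (-α))) := by
      rw [← mul_one_div R]
      gcongr
    simp only [integral_const, probReal_univ, one_smul]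
    calc _ ≤ 2 * (d * (R * (n : ℝ) ^ (-α))) + d * R * (5 ^ d * (n : ℝ) ^ (-α)) := by gcongr
      _ = _ := by ring
  · have : ∀ᵐ ω ∂P, ∀ i, X i ω ∈ ball (0 : E d) R := by
      rw [ae_all_iff]
      intro i
      have hm : AEMeasurable (X i) P := (hX i).aemeasurable
      have h := hμ
      rw [← (hX i).map_eq] at h
      exact ae_of_ae_map hm h
    filter_upwards [this] with ω hω L w hw
    exact abs_integral_sub_average_le hR hμ hk hn hω hw

end expectation

lemma extIntegral_mono {μ : Measure (E d)} {φ ψ : E d → EReal} (h : φ ≤ᵐ[μ] ψ) :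
    extIntegral φ μ ≤ extIntegral ψ μ := by
  refine EReal.sub_le_sub ?_ ?_
  · refine EReal.coe_ennreal_le_coe_ennreal_iff.2 (lintegral_mono_ae ?_)
    filter_upwards [h] with x hx using EReal.toENNReal_le_toENNReal hx
  · refine EReal.coe_ennreal_le_coe_ennreal_iff.2 (lintegral_mono_ae ?_)
    filter_upwards [h] with x hx using EReal.toENNReal_le_toENNReal (EReal.neg_le_neg_iff.2 hx)

lemma extIntegral_coe {μ : Measure (E d)} {w : E d → ℝ} (hw : Integrable w μ) :
    extIntegral (fun x => (w x : EReal)) μ = ((∫ x, w x ∂μ : ℝ) : EReal) := by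
  have h1 : ∫⁻ x, ENNReal.ofReal (w x) ∂μ ≠ ⊤ := hw.lintegral_lt_top.ne
  have h2 : ∫⁻ x, ENNReal.ofReal (-w x) ∂μ ≠ ⊤ := hw.neg.lintegral_lt_top.ne
  rw [integral_eq_lintegral_pos_part_sub_lintegral_neg_part hw, extIntegral, EReal.coe_sub,
    EReal.coe_ennreal_toReal h1, EReal.coe_ennreal_toReal h2]
  rfl

lemma isGammaZero_coe {w : E d → ℝ} (hw : ConvexOn ℝ univ w) (hc : Continuous w) :
    IsGammaZero fun x => (w x : EReal) where
  convex_epigraph := by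
    have := hw.convex_epigraph
    simpa using this
  lowerSemicontinuous := (continuous_coe_real_ereal.comp hc).lowerSemicontinuous
  ne_bot x := EReal.coe_ne_bot _
  proper := ⟨0, EReal.coe_ne_top _⟩

lemma exists_lower_bound_closedBall {w : E d → ℝ} (hw : Continuous w) (r : ℝ) :
    ∃ c, ∀ x ∈ closedBall (0 : E d) r, c ≤ w x := by
  obtain ⟨c, hc⟩ := (isCompact_closedBall (0 : E d) r).bddBelow_image hw.continuousOn
  exact ⟨c, fun x hx => hc (mem_image_of_mem w hx)⟩

lemma lipschitz_affineSup_closedBall {R : ℝ} (hR : 0 ≤ R) {w : E d → ℝ} (hw : Continuous w) :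
    LipschitzWith R.toNNReal (affineSup (closedBall 0 R) w) := by
  obtain ⟨c, hc⟩ := exists_lower_bound_closedBall hw R
  exact affineSup_lipschitz hR (nonempty_closedBall.2 hR) subset_rfl hc

section potential

variable {μ ν : Measure (E d)} {R : ℝ} {φ : E d → EReal}

lemma IsBrenierPotential.dualObjective_le [IsProbabilityMeasure μ]
    [IsProbabilityMeasure ν] (hφ : IsBrenierPotential μ ν φ) (hR : 0 < R)
    (hμ : ∀ᵐ x ∂μ, x ∈ ball 0 R) (hν : ∀ᵐ x ∂ν, x ∈ ball 0 R) {w : E d → ℝ}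
    (hw : Continuous w) :
    dualObjective μ ν φ
      ≤ ((∫ x, affineSup (closedBall 0 R) w x ∂μ + ∫ y, w y ∂ν : ℝ) : EReal) := by
  obtain ⟨c, hc⟩ := exists_lower_bound_closedBall hw R
  have hne : (closedBall (0 : E d) R).Nonempty := nonempty_closedBall.2 hR.le
  have hcont := (lipschitz_affineSup_closedBall hR.le hw).continuous
  refine (hφ.optimal _ (isGammaZero_coe (affineSup_convexOn hne subset_rfl hc) hcont)).trans ?_
  rw [dualObjective, extIntegral_coe (integrable_of_continuous hμ hcont), EReal.coe_add]
  gcongr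
  rw [← extIntegral_coe (integrable_of_continuous hν hw)]
  refine extIntegral_mono ?_
  filter_upwards [hν] with y hy
  refine iSup_le fun x => ?_
  rw [← EReal.coe_sub, EReal.coe_le_coe_iff]
  have := le_affineSup subset_rfl hc (ball_subset_closedBall hy) x
  rw [real_inner_comm] at this
  linarith

lemma IsGammaZero.exists_lower_bound (hφ : IsGammaZero φ) (r : ℝ) :
    ∃ c : ℝ, ∀ x ∈ closedBall (0 : E d) r, (c : EReal) ≤ φ x := by
  rcases (closedBall (0 : E d) r).eq_empty_or_nonempty with h | h
  · exact ⟨0, by simp [h]⟩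
  obtain ⟨x, _, hx⟩ := LowerSemicontinuousOn.exists_isMinOn h (isCompact_closedBall 0 r)
    (hφ.lowerSemicontinuous.lowerSemicontinuousOn _)
  obtain ⟨c, -, hc⟩ := EReal.lt_iff_exists_real_btwn.1 (bot_lt_iff_ne_bot.2 (hφ.ne_bot x))
  exact ⟨c, fun z hz => hc.le.trans (hx hz)⟩

lemma IsGammaZero.convexOn_toReal (hφ : IsGammaZero φ) :
    ConvexOn ℝ {x | φ x ≠ ⊤} fun x => (φ x).toReal := by
  have hcoe : ∀ x, φ x ≠ ⊤ → ((φ x).toReal : EReal) = φ x :=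
    fun x hx => EReal.coe_toReal hx (hφ.ne_bot x)
  have key : ∀ x, φ x ≠ ⊤ → ∀ z, φ z ≠ ⊤ → ∀ α β : ℝ, 0 ≤ α → 0 ≤ β → α + β = 1 →
      φ (α • x + β • z) ≤ ((α * (φ x).toReal + β * (φ z).toReal : ℝ) : EReal) := by
    intro x hx z hz α β hα hβ hαβ
    have h1 : (x, (φ x).toReal) ∈ {p : E d × ℝ | φ p.1 ≤ (p.2 : EReal)} := (hcoe x hx).ge
    have h2 : (z, (φ z).toReal) ∈ {p : E d × ℝ | φ p.1 ≤ (p.2 : EReal)} := (hcoe z hz).ge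
    exact hφ.convex_epigraph h1 h2 hα hβ hαβ
  refine ⟨fun x hx z hz α β hα hβ hαβ => ?_, fun x hx z hz α β hα hβ hαβ => ?_⟩
  · exact ((key x hx z hz α β hα hβ hαβ).trans_lt (EReal.coe_lt_top _)).ne
  · have h := key x hx z hz α β hα hβ hαβ
    have hne := (h.trans_lt (EReal.coe_lt_top _)).ne
    rw [← hcoe _ hne, EReal.coe_le_coe_iff] at h
    exact h

/-- A convex function is differentiable almost everywhere in its domain. -/
lemma ae_mem_interior_and_differentiableAt {s : Set (E d)} {w : E d → ℝ} (hw : ConvexOn ℝ s w) :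
    ∀ᵐ x : E d, x ∈ s → x ∈ interior s ∧ DifferentiableAt ℝ w x := by
  have h1 : ∀ᵐ x : E d, x ∉ frontier s := by
    rw [ae_iff]
    simpa using hw.1.addHaar_frontier volume
  have h2 : ∀ᵐ x : E d, x ∈ interior s → DifferentiableAt ℝ w x := by
    have hloc : ∀ x ∈ interior s, ∃ K, ∃ t : Set (E d), IsOpen t ∧ x ∈ t ∧
        LipschitzOnWith K w t := by
      intro x hx
      obtain ⟨K, t, ht, hK⟩ := hw.locallyLipschitzOn_interior hx
      rw [isOpen_interior.nhdsWithin_eq hx] at ht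
      obtain ⟨t', ht't, ht', hxt'⟩ := _root_.mem_nhds_iff.1 ht
      exact ⟨K, t', ht', hxt', hK.mono ht't⟩
    choose! K t ht hxt hK using hloc
    obtain ⟨T, hTs, hTc, hT⟩ := TopologicalSpace.countable_cover_nhdsWithin
      (s := interior s) (f := t) fun x hx => mem_nhdsWithin_of_mem_nhds
        ((ht x hx).mem_nhds (hxt x hx))
    have hall : ∀ᵐ x : E d, ∀ y ∈ T, x ∈ t y → DifferentiableWithinAt ℝ w (t y) x := by
      rw [ae_ball_iff hTc]
      intro y hy
      exact (hK y (hTs hy)).ae_differentiableWithinAt_of_mem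
    filter_upwards [hall] with x hx hxs
    obtain ⟨y, hyT, hxy⟩ := mem_iUnion₂.1 (hT hxs)
    exact (hx y hyT hxy).differentiableAt ((ht y (hTs hyT)).mem_nhds hxy)
  filter_upwards [h1, h2] with x hx1 hx2 hxs
  have hi : x ∈ interior s := by
    by_contra hcon
    exact hx1 ⟨subset_closure hxs, hcon⟩
  exact ⟨hi, hx2 hi⟩

/-- If `φ` dominates an integrable function with the same finite integral, then they agree almost
everywhere. -/
lemma ae_eq_of_extIntegral_le (hφ : Measurable φ) {w : E d → ℝ} (hw : Integrable w μ)
    (hle : ∀ᵐ x ∂μ, (w x : EReal) ≤ φ x)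
    (hint : extIntegral φ μ ≤ ((∫ x, w x ∂μ : ℝ) : EReal)) : ∀ᵐ x ∂μ, φ x = w x := by
  have h1 : ∫⁻ x, ENNReal.ofReal (w x) ∂μ ≠ ⊤ := hw.lintegral_lt_top.ne
  have h2 : ∫⁻ x, ENNReal.ofReal (-w x) ∂μ ≠ ⊤ := hw.neg.lintegral_lt_top.ne
  have hp : (fun x => ENNReal.ofReal (w x)) ≤ᵐ[μ] fun x => (φ x).toENNReal := by
    filter_upwards [hle] with x hx using EReal.toENNReal_le_toENNReal hx
  have hm : (fun x => (-φ x).toENNReal) ≤ᵐ[μ] fun x => ENNReal.ofReal (-w x) := by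
    filter_upwards [hle] with x hx
    exact EReal.toENNReal_le_toENNReal (y := ((-w x : ℝ) : EReal))
      (by rw [EReal.coe_neg]; exact EReal.neg_le_neg_iff.2 hx)
  have hmfin : ∫⁻ x, (-φ x).toENNReal ∂μ ≠ ⊤ := ne_top_of_le_ne_top h2 (lintegral_mono_ae hm)
  have hpfin : ∫⁻ x, (φ x).toENNReal ∂μ ≠ ⊤ := by
    intro htop
    rw [extIntegral, htop] at hint
    lift ∫⁻ x, (-φ x).toENNReal ∂μ to NNReal using hmfin with b
    exact absurd hint (not_le.2 (by
      rw [EReal.coe_ennreal_top, EReal.coe_nnreal_eq_coe_real, EReal.top_sub_coe]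
      exact EReal.coe_lt_top _))
  have hsub : (∫⁻ x, (φ x).toENNReal ∂μ).toReal - (∫⁻ x, (-φ x).toENNReal ∂μ).toReal
      ≤ (∫⁻ x, ENNReal.ofReal (w x) ∂μ).toReal - (∫⁻ x, ENNReal.ofReal (-w x) ∂μ).toReal := by
    rw [extIntegral, integral_eq_lintegral_pos_part_sub_lintegral_neg_part hw,
      ← EReal.coe_ennreal_toReal hpfin, ← EReal.coe_ennreal_toReal hmfin, ← EReal.coe_sub,
      EReal.coe_le_coe_iff] at hint
    exact hint
  have hp' := ENNReal.toReal_mono hpfin (lintegral_mono_ae hp)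
  have hm' := ENNReal.toReal_mono h2 (lintegral_mono_ae hm)
  have hpe := ae_eq_of_ae_le_of_lintegral_le hp h1
    (measurable_ereal_toENNReal.comp hφ).aemeasurable
    ((ENNReal.toReal_le_toReal hpfin h1).1 (by linarith))
  have hme := ae_eq_of_ae_le_of_lintegral_le hm hmfin
    hw.neg.aemeasurable.ennreal_ofReal
    ((ENNReal.toReal_le_toReal h2 hmfin).1 (by linarith))
  filter_upwards [hpe, hme, hle] with x hx1 hx2 hx3
  refine le_antisymm ?_ hx3
  have hnt : φ x ≠ ⊤ := by
    rw [← EReal.toENNReal_ne_top_iff, ← hx1]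
    exact ENNReal.ofReal_ne_top
  have hnb : φ x ≠ ⊥ := (lt_of_lt_of_le (EReal.bot_lt_coe _) hx3).ne'
  lift φ x to ℝ using ⟨hnt, hnb⟩ with r
  rw [EReal.coe_le_coe_iff]
  rcases le_or_gt 0 r with h | h
  · rw [EReal.real_coe_toENNReal] at hx1
    rcases h.eq_or_lt with h0 | h0
    · rw [← EReal.coe_neg, EReal.real_coe_toENNReal, ← h0] at hx2
      have : ENNReal.ofReal (-w x) = 0 := by rw [← hx2]; simp
      rw [ENNReal.ofReal_eq_zero] at this
      linarith
    · exact ((ENNReal.ofReal_le_ofReal_iff' .. ).1 hx1.ge).resolve_right (by linarith)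
  · rw [← EReal.coe_neg, EReal.real_coe_toENNReal] at hx2
    have h3 := (ENNReal.ofReal_le_ofReal_iff' .. ).1 hx2.ge
    have h4 : w x ≤ r := EReal.coe_le_coe_iff.1 hx3
    rcases h3 with h3 | h3 <;> linarith

/-- A Brenier potential agrees almost everywhere with the supremum of affine functions given by a
Lipschitz function `a`; this pair is optimal among pairs given by continuous functions, and the
gradient of the potential is almost everywhere a subgradient. -/
lemma IsBrenierPotential.exists_lipschitz_pair [IsProbabilityMeasure μ]
    [IsProbabilityMeasure ν] (hφ : IsBrenierPotential μ ν φ) (hR : 0 < R)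
    (hμ : ∀ᵐ x ∂μ, x ∈ ball 0 R) (hν : ∀ᵐ x ∂ν, x ∈ ball 0 R) (hac : μ ≪ volume) :
    ∃ a : E d → ℝ, LipschitzWith (2 * R).toNNReal a ∧
      (∀ w : E d → ℝ, Continuous w →
        ∫ x, affineSup (closedBall 0 R) a x ∂μ + ∫ y, a y ∂ν
          ≤ ∫ x, affineSup (closedBall 0 R) w x ∂μ + ∫ y, w y ∂ν) ∧
      ∀ᵐ x ∂μ, ∀ z, affineSup (closedBall 0 R) a x + inner ℝ (extGradient φ x) (z - x)
        ≤ affineSup (closedBall 0 R) a z := by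
  have hΓ := hφ.gammaZero
  obtain ⟨c, hc⟩ := hΓ.exists_lower_bound (2 * R)
  set S : Set (E d) := closedBall 0 (2 * R) ∩ {x | φ x ≠ ⊤} with hS
  have hSsub : S ⊆ closedBall 0 (2 * R) := inter_subset_left
  have hcoe : ∀ x, φ x ≠ ⊤ → ((φ x).toReal : EReal) = φ x :=
    fun x hx => EReal.coe_toReal hx (hΓ.ne_bot x)
  have hcS : ∀ x ∈ S, c ≤ (φ x).toReal := by
    intro x hx
    rw [← EReal.coe_le_coe_iff, hcoe x hx.2]
    exact hc x hx.1
  have hconj_bot : extIntegral (conjugate φ) ν ≠ ⊥ := by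
    obtain ⟨x₀, hx₀⟩ := hΓ.proper
    have hcont : Continuous fun y : E d => inner ℝ x₀ y - (φ x₀).toReal := by fun_prop
    have h := extIntegral_mono (μ := ν) (φ := fun y => ((inner ℝ x₀ y - (φ x₀).toReal : ℝ) : EReal))
      (ψ := conjugate φ) (.of_forall fun y => by
        refine le_iSup_of_le x₀ ?_
        simp only
        rw [EReal.coe_sub, hcoe x₀ hx₀])
    rw [extIntegral_coe (integrable_of_continuous hν hcont)] at h
    exact (lt_of_lt_of_le (EReal.bot_lt_coe _) h).ne'
  have hSne : S.Nonempty := by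
    by_contra hcon
    have htop : ∀ᵐ x ∂μ, φ x = ⊤ := by
      filter_upwards [hμ] with x hx
      by_contra h
      refine hcon ⟨x, ?_, h⟩
      rw [mem_ball_zero_iff] at hx
      rw [mem_closedBall_zero_iff]
      linarith
    have h1 : extIntegral φ μ = ⊤ := by
      have e1 : ∫⁻ x, (φ x).toENNReal ∂μ = ⊤ := by
        rw [lintegral_congr_ae (g := fun _ => ⊤)
          (by filter_upwards [htop] with x hx; simp [hx])]
        simp
      have e2 : ∫⁻ x, (-φ x).toENNReal ∂μ = 0 := by
        rw [lintegral_congr_ae (g := fun _ => 0)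
          (by filter_upwards [htop] with x hx; simp [hx])]
        simp
      rw [extIntegral, e1, e2]
      simp
    have h2 := hφ.dualObjective_le hR hμ hν (w := fun _ => 0) continuous_const
    rw [dualObjective, h1, EReal.top_add_of_ne_bot hconj_bot] at h2
    exact absurd h2 (not_le.2 (EReal.coe_lt_top _))
  set a := affineSup S fun x => (φ x).toReal with ha
  have haL : LipschitzWith (2 * R).toNNReal a := affineSup_lipschitz (by linarith) hSne hSsub hcS
  obtain ⟨ca, hca⟩ := exists_lower_bound_closedBall haL.continuous R
  have hKne : (closedBall (0 : E d) R).Nonempty := nonempty_closedBall.2 hR.le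
  set u := affineSup (closedBall 0 R) a with hu
  have huL : LipschitzWith R.toNNReal u := lipschitz_affineSup_closedBall hR.le haL.continuous
  have huφ : ∀ x ∈ ball (0 : E d) (2 * R), (u x : EReal) ≤ φ x := by
    intro x hx
    by_cases hxt : φ x = ⊤
    · simp [hxt]
    rw [← hcoe x hxt, EReal.coe_le_coe_iff]
    refine affineSup_le hKne fun y _ => ?_
    have := le_affineSup hSsub hcS ⟨ball_subset_closedBall hx, hxt⟩ y
    rw [real_inner_comm]
    linarith
  have hballs : ball (0 : E d) R ⊆ ball 0 (2 * R) := ball_subset_ball (by linarith)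
  have huφ' : ∀ᵐ x ∂μ, (u x : EReal) ≤ φ x := by
    filter_upwards [hμ] with x hx using huφ x (hballs hx)
  have haφ : ∀ y, (a y : EReal) ≤ conjugate φ y := by
    intro y
    by_contra! hlt
    obtain ⟨r, hr1, hr2⟩ := EReal.lt_iff_exists_real_btwn.1 hlt
    rw [EReal.coe_lt_coe_iff] at hr2
    refine absurd hr2 (not_lt.2 (affineSup_le hSne fun x hx => ?_))
    rw [← EReal.coe_le_coe_iff, EReal.coe_sub, hcoe x hx.2]
    exact (le_iSup (fun x => ((inner ℝ x y : ℝ) : EReal) - φ x) x).trans hr1.le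
  have huI := integrable_of_continuous hμ huL.continuous
  have haI := integrable_of_continuous hν haL.continuous
  have hI1 : ((∫ x, u x ∂μ : ℝ) : EReal) ≤ extIntegral φ μ := by
    rw [← extIntegral_coe huI]
    exact extIntegral_mono huφ'
  have hI2 : ((∫ y, a y ∂ν : ℝ) : EReal) ≤ extIntegral (conjugate φ) ν := by
    rw [← extIntegral_coe haI]
    exact extIntegral_mono (.of_forall haφ)
  refine ⟨a, haL, fun w hw => ?_, ?_⟩
  · have h := hφ.dualObjective_le hR hμ hν hw
    have h' := (add_le_add hI1 hI2).trans h
    rw [← EReal.coe_add, EReal.coe_le_coe_iff] at h'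
    exact h'
  · have h := hφ.dualObjective_le hR hμ hν haL.continuous
    have hle : extIntegral φ μ ≤ ((∫ x, u x ∂μ : ℝ) : EReal) := by
      have h' := (add_le_add (le_refl (extIntegral φ μ)) hI2).trans h
      rw [EReal.coe_add] at h'
      exact (EReal.addLECancellable_coe _).add_le_add_iff_right.1 h'
    have heq := ae_eq_of_extIntegral_le hΓ.lowerSemicontinuous.measurable huI huφ' hle
    have hdiff := hac.ae_le (ae_mem_interior_and_differentiableAt hΓ.convexOn_toReal)
    filter_upwards [heq, hdiff, hμ] with x hxe hxd hxR z
    have hxt : φ x ≠ ⊤ := by rw [hxe]; exact EReal.coe_ne_top _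
    obtain ⟨hxi, hxd⟩ := hxd hxt
    obtain ⟨p, hp, hpx⟩ := exists_eq_affineSup hKne (isCompact_closedBall 0 R)
      haL.continuous.continuousOn x
    have hsub := subgradient_affineSup (subset_rfl) hca hp hpx
    have hmin : IsLocalMin (fun z => (φ z).toReal - inner ℝ p z) x := by
      have hnhds : interior {x | φ x ≠ ⊤} ∩ ball 0 (2 * R) ∈ nhds x :=
        (isOpen_interior.inter isOpen_ball).mem_nhds ⟨hxi, hballs hxR⟩
      filter_upwards [hnhds] with z hz
      have h1 := huφ z hz.2
      rw [← hcoe z (interior_subset hz.1), EReal.coe_le_coe_iff] at h1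
      have h2 := hsub z
      rw [inner_sub_right] at h2
      rw [hxe, EReal.toReal_coe]
      linarith
    have hgrad : extGradient φ x = p := by
      have hf := hxd.hasFDerivAt.sub (innerSL ℝ p).hasFDerivAt
      have h0 := hmin.hasFDerivAt_eq_zero hf
      rw [extGradient, gradient, sub_eq_zero.1 h0]
      exact (InnerProductSpace.toDual ℝ (E d)).symm_apply_apply p
    rw [hgrad]
    exact hsub z

end potential

lemma continuous_secondDiff {w : E d → ℝ} (hw : Continuous w) (k : E d) :
    Continuous (secondDiff w k) := by
  unfold secondDiff; fun_prop

/-- The gap of the dual functional between the pair generated by `v` and an optimal pair controls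
the distance between subgradients. -/
lemma lintegral_sub_subgradient_le {μ ν : Measure (E d)} [IsProbabilityMeasure μ]
    [IsProbabilityMeasure ν] {R M : ℝ} (hR : 0 < R) (hM : 0 ≤ M)
    (hμ : ∀ᵐ x ∂μ, x ∈ ball 0 R) (hν : ∀ᵐ x ∂ν, x ∈ ball 0 R) (hden : HasDensityAtMost μ M)
    {a : E d → ℝ} (ha : Continuous a)
    (hopt : ∀ w : E d → ℝ, Continuous w →
      ∫ x, affineSup (closedBall 0 R) a x ∂μ + ∫ y, a y ∂ν
        ≤ ∫ x, affineSup (closedBall 0 R) w x ∂μ + ∫ y, w y ∂ν)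
    {p q : E d → E d}
    (hp : ∀ᵐ x ∂μ, ∀ z, affineSup (closedBall 0 R) a x + inner ℝ (p x) (z - x)
      ≤ affineSup (closedBall 0 R) a z)
    {v : E d → ℝ} (hv : LipschitzWith R.toNNReal v)
    (hq : ∀ x z, v x + inner ℝ (q x) (z - x) ≤ v z) {t : ℝ} (ht : 0 < t) (htR : t ≤ R) :
    ∫⁻ x, ‖p x - q x‖ₑ ∂μ ≤ ENNReal.ofReal (d * (t⁻¹ *
      (∫ x, v x ∂μ + ∫ y, affineSup (closedBall 0 (2 * R)) v y ∂ν
        - ∫ x, affineSup (closedBall 0 R) a x ∂μ - ∫ y, a y ∂ν)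
      + 2 * M * (volume : Measure (E d)).real (closedBall 0 (3 * R)) * t)) := by
  set u := affineSup (closedBall 0 R) a with hu
  set b := affineSup (closedBall 0 (2 * R)) v with hb
  set s := affineSup (closedBall 0 R) (fun y => (a y + b y) / 2) with hs
  set V := (volume : Measure (E d)).real (closedBall 0 (3 * R)) with hV
  have h2R : 0 ≤ 2 * R := by linarith
  have hKne : (closedBall (0 : E d) R).Nonempty := nonempty_closedBall.2 hR.le
  have hbL : LipschitzWith (2 * R).toNNReal b := lipschitz_affineSup_closedBall h2R hv.continuous
  have huL : LipschitzWith R.toNNReal u := lipschitz_affineSup_closedBall hR.le ha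
  have hbc := hbL.continuous
  have hmid : Continuous fun y => (a y + b y) / 2 := by fun_prop
  have hsL : LipschitzWith R.toNNReal s := lipschitz_affineSup_closedBall hR.le hmid
  obtain ⟨ca, hca⟩ := exists_lower_bound_closedBall ha R
  obtain ⟨cv, hcv⟩ := exists_lower_bound_closedBall hv.continuous (2 * R)
  have huI := integrable_of_continuous hμ huL.continuous
  have hvI := integrable_of_continuous hμ hv.continuous
  have hsI := integrable_of_continuous hμ hsL.continuous
  have haI := integrable_of_continuous hν ha
  have hbI := integrable_of_continuous hν hbc
  have huvI : Integrable (fun x => u x + v x) μ := huI.add hvI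
  have huvsI : Integrable (fun x => u x + v x - 2 * s x) μ := huvI.sub (hsI.const_mul 2)
  set e : Fin d → E d := fun i => t • EuclideanSpace.single i (1 : ℝ) with he
  have hen : ∀ i, ‖e i‖ = t := by
    intro i
    simp [he, norm_smul, abs_of_pos ht]
  have hsu : ∀ k x, 0 ≤ secondDiff u k x := by
    intro k x
    obtain ⟨y, hy, hyx⟩ := exists_eq_affineSup hKne (isCompact_closedBall 0 R) ha.continuousOn x
    exact secondDiff_nonneg_of_subgradient (subgradient_affineSup subset_rfl hca hy hyx) k
  have hsv : ∀ k x, 0 ≤ secondDiff v k x := fun k x =>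
    secondDiff_nonneg_of_subgradient (hq x) k
  have hsuI := fun i => integrable_of_continuous hμ (continuous_secondDiff huL.continuous (e i))
  have hsvI := fun i => integrable_of_continuous hμ (continuous_secondDiff hv.continuous (e i))
  have hsuvI : ∀ i, Integrable (fun x => secondDiff u (e i) x + secondDiff v (e i) x) μ :=
    fun i => (hsuI i).add (hsvI i)
  have hmidle : ∀ x ∈ ball (0 : E d) R, ∀ k : E d, ‖k‖ ≤ R →
      2 * s x ≤ u (x + k) + v (x - k) := by
    intro x hx k hk
    refine affineSup_midpoint_le hKne subset_rfl hca fun y _ => ?_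
    have hmem : x - k ∈ closedBall (0 : E d) (2 * R) := by
      rw [mem_closedBall_zero_iff]
      rw [mem_ball_zero_iff] at hx
      linarith [norm_sub_le x k]
    have := le_affineSup subset_rfl hcv hmem y
    linarith
  set F : E d → ℝ := fun x => ∑ i, t⁻¹ * ((u x + v x - 2 * s x) +
    (secondDiff u (e i) x + secondDiff v (e i) x)) with hF
  have hFI : ∀ i, Integrable (fun x => t⁻¹ * ((u x + v x - 2 * s x) +
      (secondDiff u (e i) x + secondDiff v (e i) x))) μ := fun i =>
    (huvsI.add (hsuvI i)).const_mul _
  have hpt : ∀ᵐ x ∂μ, ‖p x - q x‖ ≤ F x := by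
    filter_upwards [hp, hμ] with x hpx hx
    refine (norm_le_sum_abs_inner _).trans (Finset.sum_le_sum fun i _ => ?_)
    have hei : ‖e i‖ ≤ R := (hen i).le.trans htR
    have h1 := hmidle x hx (e i) hei
    have h2 := hmidle x hx (-e i) (by rwa [norm_neg])
    rw [sub_neg_eq_add, ← sub_eq_add_neg] at h2
    have h3 := abs_inner_sub_le_of_subgradient hpx (hq x) h1 h2
    rw [he, inner_smul_right, abs_mul, abs_of_pos ht] at h3
    rw [le_inv_mul_iff₀ ht]
    linarith
  have hgap : ∫ x, (u x + v x - 2 * s x) ∂μ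
      ≤ ∫ x, v x ∂μ + ∫ y, b y ∂ν - ∫ x, u x ∂μ - ∫ y, a y ∂ν := by
    have h := hopt _ hmid
    have e1 : ∫ y, (a y + b y) / 2 ∂ν = (∫ y, a y ∂ν + ∫ y, b y ∂ν) / 2 := by
      rw [integral_div, integral_add haI hbI]
    have e2 : ∫ x, (u x + v x - 2 * s x) ∂μ = ∫ x, u x ∂μ + ∫ x, v x ∂μ - 2 * ∫ x, s x ∂μ := by
      rw [integral_sub huvI (hsI.const_mul 2), integral_add huI hvI, integral_const_mul]
    rw [e1] at h
    rw [e2]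
    linarith
  have hsec : ∀ i, ∫ x, (secondDiff u (e i) x + secondDiff v (e i) x) ∂μ
      ≤ 2 * M * V * t ^ 2 := by
    intro i
    have hei : ‖e i‖ ≤ R := (hen i).le.trans htR
    have h1 := integral_secondDiff_le hR hM hμ hden huL hei (hsu (e i))
    have h2 := integral_secondDiff_le hR hM hμ hden hv hei (hsv (e i))
    rw [hen i] at h1 h2
    rw [integral_add (hsuI i) (hsvI i)]
    linarith
  have hFle : ∫ x, F x ∂μ ≤ d * (t⁻¹ *
      (∫ x, v x ∂μ + ∫ y, b y ∂ν - ∫ x, u x ∂μ - ∫ y, a y ∂ν) + 2 * M * V * t) := by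
    rw [hF, integral_finsetSum _ fun i _ => hFI i]
    have h1 : ∀ i ∈ Finset.univ, ∫ x, t⁻¹ * ((u x + v x - 2 * s x) +
        (secondDiff u (e i) x + secondDiff v (e i) x)) ∂μ ≤ t⁻¹ *
        (∫ x, v x ∂μ + ∫ y, b y ∂ν - ∫ x, u x ∂μ - ∫ y, a y ∂ν) + 2 * M * V * t := by
      intro i _
      rw [integral_const_mul, integral_add huvsI (hsuvI i)]
      have h2 := mul_le_mul_of_nonneg_left (add_le_add hgap (hsec i)) (inv_pos.2 ht).le
      refine h2.trans (le_of_eq ?_)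
      field_simp
    simpa [← mul_add] using Finset.sum_le_card_nsmul _ _ _ h1
  calc ∫⁻ x, ‖p x - q x‖ₑ ∂μ ≤ ∫⁻ x, ENNReal.ofReal (F x) ∂μ := by
        refine lintegral_mono_ae ?_
        filter_upwards [hpt] with x hx
        rw [← ofReal_norm]
        exact ENNReal.ofReal_le_ofReal hx
    _ = ENNReal.ofReal (∫ x, F x ∂μ) := by
        rw [ofReal_integral_eq_lintegral_ofReal (integrable_finsetSum _ fun i _ => hFI i)]
        filter_upwards [hpt] with x hx using (norm_nonneg _).trans hx
    _ ≤ _ := ENNReal.ofReal_le_ofReal hFle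

/-- Optimality in the dual linear program, in terms of potentials. -/
lemma IsEmpiricalDualOptimal.average_le {n m : ℕ} (hm : 0 < m) {x : Fin n → E d}
    {y : Fin m → E d} {f : Fin n → ℝ} {g : Fin m → ℝ} (h : IsEmpiricalDualOptimal x y f g)
    {u a : E d → ℝ} (hua : ∀ i j, inner ℝ (x i) (y j) ≤ u (x i) + a (y j))
    {A : Set (E d)} (hA : A.Nonempty) :
    (n : ℝ)⁻¹ * ∑ i, explicitPotential y g (x i)
        + (m : ℝ)⁻¹ * ∑ j, affineSup A (explicitPotential y g) (y j)
      ≤ (n : ℝ)⁻¹ * ∑ i, u (x i) + (m : ℝ)⁻¹ * ∑ j, a (y j) := by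
  have hsq : ∀ i j, ‖x i - y j‖ ^ 2 / 2
      = ‖x i‖ ^ 2 / 2 - inner ℝ (x i) (y j) + ‖y j‖ ^ 2 / 2 := by
    intro i j
    rw [norm_sub_sq_real]
    ring
  have hfeas := h.feasible
  have hopt := h.optimal (fun i => ‖x i‖ ^ 2 / 2 - u (x i)) (fun j => ‖y j‖ ^ 2 / 2 - a (y j))
    (fun i j => by
      rw [hsq]
      linarith [hua i j])
  have hf : ∀ i, explicitPotential y g (x i) ≤ ‖x i‖ ^ 2 / 2 - f i := by
    intro i
    refine explicitPotential_le hm fun k => ?_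
    have := hfeas i k
    rw [hsq] at this
    rw [affinePiece]
    linarith
  have hg : ∀ j, affineSup A (explicitPotential y g) (y j) ≤ ‖y j‖ ^ 2 / 2 - g j := by
    intro j
    refine affineSup_le hA fun z _ => ?_
    have := affinePiece_le_explicitPotential (y := y) (g := g) j z
    rw [affinePiece] at this
    linarith
  have hf' := Finset.sum_le_sum fun i (_ : i ∈ Finset.univ) => hf i
  have hg' := Finset.sum_le_sum fun j (_ : j ∈ Finset.univ) => hg j
  have hf'' := mul_le_mul_of_nonneg_left hf' (inv_nonneg.2 (Nat.cast_nonneg (α := ℝ) n))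
  have hg'' := mul_le_mul_of_nonneg_left hg' (inv_nonneg.2 (Nat.cast_nonneg (α := ℝ) m))
  simp only [← Finset.sum_mul, Finset.sum_sub_distrib] at hopt hf'' hg''
  linarith

lemma sqrt_le_rate (hd : 0 < d) {n m : ℕ} (hn : 0 < n) (hm : 0 < m) :
    √((n : ℝ) ^ (-discrepancyExponent d) + (m : ℝ) ^ (-discrepancyExponent d))
      ≤ 4 * rate d n m := by
  set α := discrepancyExponent d with hα
  have hn' : (0 : ℝ) < n := Nat.cast_pos.2 hn
  have hm' : (0 : ℝ) < m := Nat.cast_pos.2 hm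
  have hsq : ∀ r : ℝ, 0 < r → (r ^ (-α)) ^ 2 = r ^ (-(2 * α)) := by
    intro r hr
    rw [← Real.rpow_natCast, ← Real.rpow_mul hr.le]
    congr 1
    push_cast
    ring
  have key : ∀ B : ℝ, 0 ≤ B → (n : ℝ) ^ (-(2 * α)) + (m : ℝ) ^ (-(2 * α)) ≤ 2 * B →
      √((n : ℝ) ^ (-α) + (m : ℝ) ^ (-α)) ≤ 4 * B ^ (1 / 4 : ℝ) := by
    intro B hB hle
    have h1 : ((n : ℝ) ^ (-α) + (m : ℝ) ^ (-α)) ^ 2 ≤ 4 * B := by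
      rw [← hsq _ hn', ← hsq _ hm'] at hle
      nlinarith [sq_nonneg ((n : ℝ) ^ (-α) - (m : ℝ) ^ (-α))]
    have hnn : 0 ≤ (n : ℝ) ^ (-α) + (m : ℝ) ^ (-α) := by positivity
    have h2 : √((n : ℝ) ^ (-α) + (m : ℝ) ^ (-α))
        = (((n : ℝ) ^ (-α) + (m : ℝ) ^ (-α)) ^ 2) ^ (1 / 4 : ℝ) := by
      rw [Real.sqrt_eq_rpow, ← Real.rpow_natCast, ← Real.rpow_mul hnn]
      norm_num
    rw [h2]
    calc _ ≤ (4 * B) ^ (1 / 4 : ℝ) := Real.rpow_le_rpow (by positivity) h1 (by norm_num)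
      _ = (4 : ℝ) ^ (1 / 4 : ℝ) * B ^ (1 / 4 : ℝ) := Real.mul_rpow (by norm_num) hB
      _ ≤ 4 * B ^ (1 / 4 : ℝ) := by
        gcongr
        calc (4 : ℝ) ^ (1 / 4 : ℝ) ≤ 4 ^ (1 : ℝ) :=
              Real.rpow_le_rpow_of_exponent_le (by norm_num) (by norm_num)
          _ = 4 := Real.rpow_one 4
  have hlog : ∀ k : ℕ, 0 < k → 1 / 2 ≤ Real.log (1 + k) := by
    intro k hk
    have h1 : (1 : ℝ) ≤ k := by exact_mod_cast hk
    have h2 : Real.log 2 ≤ Real.log (1 + k) := Real.log_le_log (by norm_num) (by linarith)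
    linarith [Real.log_two_gt_d9]
  have hsmall : d ≤ 2 → 2 * α = 1 / 2 := by
    intro h
    have h' : (d : ℝ) ≤ 2 := by exact_mod_cast h
    rw [hα, discrepancyExponent, max_eq_right h']
    norm_num
  unfold rate
  split_ifs with h1 h2
  · refine key _ (by positivity) ?_
    rw [hsmall (by omega)]
    have : 0 ≤ (n : ℝ) ^ (-(1 / 2) : ℝ) + (m : ℝ) ^ (-(1 / 2) : ℝ) := by positivity
    linarith
  · have hln := hlog n hn
    have hlm := hlog m hm
    have hpn : 0 < (n : ℝ) ^ (-(1 / 2) : ℝ) := by positivity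
    have hpm : 0 < (m : ℝ) ^ (-(1 / 2) : ℝ) := by positivity
    refine key _ (by nlinarith) ?_
    rw [hsmall (by omega)]
    nlinarith
  · have h' : (2 : ℝ) ≤ d := by exact_mod_cast (by omega : 2 ≤ d)
    have hα' : 2 * α = 1 / (d : ℝ) := by
      rw [hα, discrepancyExponent, max_eq_left h']
      field_simp
    refine key _ (by positivity) ?_
    rw [hα']
    have : 0 ≤ (n : ℝ) ^ (-(1 / (d : ℝ))) + (m : ℝ) ^ (-(1 / (d : ℝ))) := by positivity
    linarith

lemma ae_mem_ball_of_support_subset {μ : Measure (E d)} {R : ℝ} (h : μ.support ⊆ ball 0 R) :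
    ∀ᵐ x ∂μ, x ∈ ball 0 R :=
  Filter.mem_of_superset Measure.support_mem_ae h

end BrenierEstimation

end

open BrenierEstimation in
theorem mainTheorem1 (d : ℕ) (hd : 0 < d) (R M : ℝ) (hR : 0 < R) (hM : 0 < M) :
    ∃ C : ℝ, 0 < C ∧
      ∀ (μ ν : Measure (E d)) [IsProbabilityMeasure μ] [IsProbabilityMeasure ν],
        μ.support ⊆ Metric.ball 0 R → ν.support ⊆ Metric.ball 0 R →
        HasDensityAtMost μ M →
      ∀ φbar : E d → EReal, IsBrenierPotential μ ν φbar →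
      ∀ (n m : ℕ), 0 < n → 0 < m →
      ∀ {Ω : Type*} [MeasurableSpace Ω] (P : Measure Ω) [IsProbabilityMeasure P]
        (X : Fin n → Ω → E d) (Y : Fin m → Ω → E d),
        (∀ i, HasLaw (X i) μ P) → iIndepFun X P →
        (∀ j, HasLaw (Y j) ν P) → iIndepFun Y P →
      ∀ (f : Ω → Fin n → ℝ) (g : Ω → Fin m → ℝ),
        (∀ᵐ ω ∂P, IsEmpiricalDualOptimal (fun i => X i ω) (fun j => Y j ω) (f ω) (g ω)) →
        ∫⁻ ω, ∫⁻ x, ‖extGradient φbar x - mongeEstimator (fun j => Y j ω) (g ω) x‖ₑ ∂μ ∂P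
          ≤ ENNReal.ofReal (C * rate d n m) := by
  set V := (volume : Measure (E d)).real (Metric.closedBall 0 (3 * R)) with hV
  set C₀ : ℝ := d * R * (2 + 5 ^ d) with hC₀
  have hd' : (0 : ℝ) < d := Nat.cast_pos.2 hd
  have hV0 : 0 ≤ V := measureReal_nonneg
  refine ⟨d * (8 * C₀ + M * V * R) * 4, by positivity, ?_⟩
  intro μ ν _ _ hμs hνs hden φ hφ n m hn hm Ω _ P _ X Y hX hXi hY hYi f g hopt
  have hμ := ae_mem_ball_of_support_subset hμs
  have hν := ae_mem_ball_of_support_subset hνs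
  have hac : μ ≪ volume := by
    obtain ⟨ρ, -, rfl, -⟩ := hden
    exact withDensity_absolutelyContinuous _ _
  obtain ⟨a, haL, hmin, hsub⟩ := hφ.exists_lipschitz_pair hR hμ hν hac
  obtain ⟨D, hDI, hD0, hDle, hD⟩ := exists_discrepancy_bound hR hμ hn hX hXi
  obtain ⟨D', hDI', hD0', hDle', hD'⟩ := exists_discrepancy_bound hR hν hm hY hYi
  have hYball : ∀ᵐ ω ∂P, ∀ j, Y j ω ∈ Metric.ball (0 : E d) R := by
    rw [ae_all_iff]
    intro j
    have h := hν
    rw [← (hY j).map_eq] at h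
    exact ae_of_ae_map (hY j).aemeasurable h
  set r := (n : ℝ) ^ (-discrepancyExponent d) + (m : ℝ) ^ (-discrepancyExponent d) with hr
  have hα := discrepancyExponent_pos d
  have hone : ∀ k : ℕ, 0 < k → (k : ℝ) ^ (-discrepancyExponent d) ≤ 1 := fun k hk =>
    Real.rpow_le_one_of_one_le_of_nonpos (by exact_mod_cast hk) (by linarith)
  have hr2 : r ≤ 2 := by linarith [hone n hn, hone m hm]
  have hr0 : 0 < r := by
    have : (0 : ℝ) < n := Nat.cast_pos.2 hn
    positivity
  have hσ0 : 0 < √r := Real.sqrt_pos.2 hr0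
  have hσ2 : √r ≤ 2 := by
    rw [Real.sqrt_le_left (by norm_num)]
    linarith
  set t := R * √r / 2 with ht
  have ht0 : 0 < t := by positivity
  have htR : t ≤ R := by
    rw [ht]
    nlinarith
  set u := affineSup (Metric.closedBall 0 R) a with hu
  have huL : LipschitzWith R.toNNReal u := lipschitz_affineSup_closedBall hR.le haL.continuous
  obtain ⟨ca, hca⟩ := exists_lower_bound_closedBall haL.continuous R
  have hpoint : ∀ᵐ ω ∂P,
      ∫⁻ x, ‖extGradient φ x - mongeEstimator (fun j => Y j ω) (g ω) x‖ₑ ∂μ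
        ≤ ENNReal.ofReal (d * (t⁻¹ * (4 * R * (D ω + D' ω)) + 2 * M * V * t)) := by
    filter_upwards [hopt, hD, hD', hYball] with ω hω hDω hDω' hYω
    have hvL : LipschitzWith R.toNNReal (explicitPotential (fun j => Y j ω) (g ω)) :=
      explicitPotential_lipschitz hm hR.le fun j => (mem_ball_zero_iff.1 (hYω j)).le
    refine (lintegral_sub_subgradient_le hR hM.le hμ hν hden haL.continuous hmin hsub hvL
      (fun x z => subgradient_mongeEstimator hm x z) ht0 htR).trans ?_
    refine ENNReal.ofReal_le_ofReal ?_
    gcongr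
    have hbL : LipschitzWith (2 * R).toNNReal
        (affineSup (Metric.closedBall 0 (2 * R)) (explicitPotential (fun j => Y j ω) (g ω))) :=
      lipschitz_affineSup_closedBall (by linarith) hvL.continuous
    have hdual := hω.average_le hm (u := u) (a := a) (A := Metric.closedBall 0 (2 * R))
      (fun i j => by
        have := le_affineSup subset_rfl hca (Metric.ball_subset_closedBall (hYω j)) (X i ω)
        rw [real_inner_comm] at this
        linarith)
      (Metric.nonempty_closedBall.2 (by linarith))
    have h1 := (abs_le.1 (hDω _ _ hvL)).2
    have h2 := (abs_le.1 (hDω _ _ huL)).1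
    have h3 := (abs_le.1 (hDω' _ _ hbL)).2
    have h4 := (abs_le.1 (hDω' _ _ haL)).1
    rw [Real.coe_toNNReal _ hR.le] at h1 h2
    rw [Real.coe_toNNReal _ (by linarith)] at h3 h4
    have h5 := mul_nonneg hR.le (hD0 ω)
    linarith
  have hDD : Integrable (fun ω => t⁻¹ * (4 * R * (D ω + D' ω))) P :=
    ((hDI.add hDI').const_mul _).const_mul _
  have hI : Integrable (fun ω => d * (t⁻¹ * (4 * R * (D ω + D' ω)) + 2 * M * V * t)) P :=
    (hDD.add (integrable_const _)).const_mul _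
  refine (lintegral_mono_ae hpoint).trans ?_
  rw [← ofReal_integral_eq_lintegral_ofReal hI (.of_forall fun ω => by
    have h1 := hD0 ω
    have h2 := hD0' ω
    simp only [Pi.zero_apply]
    positivity)]
  refine ENNReal.ofReal_le_ofReal ?_
  rw [integral_const_mul, integral_add hDD (integrable_const _), integral_const_mul,
    integral_const_mul, integral_add hDI hDI']
  simp only [integral_const, probReal_univ, one_smul]
  have hsqrt : √r * √r = r := Real.mul_self_sqrt hr0.le
  calc d * (t⁻¹ * (4 * R * (∫ ω, D ω ∂P + ∫ ω, D' ω ∂P)) + 2 * M * V * t)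
      ≤ d * (t⁻¹ * (4 * R * (C₀ * r)) + 2 * M * V * t) := by
        have : ∫ ω, D ω ∂P + ∫ ω, D' ω ∂P ≤ C₀ * r := by
          rw [hr, mul_add]
          exact add_le_add hDle hDle'
        gcongr
    _ = d * (8 * C₀ + M * V * R) * √r := by
        nth_rewrite 1 [← hsqrt]
        rw [ht]
        field_simp
        ring
    _ ≤ d * (8 * C₀ + M * V * R) * (4 * rate d n m) := by
        gcongr
        exact sqrt_le_rate hd hn hm
    _ = _ := by ring
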